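/- **Approximate Hamilton–Jacobi equation in finite volume, for tensors.** Let $P$ be a probability measure on $\mathbb{R}$ with bounded support and let $p \ge 1$ be an integer. For every integer $N \ge 1$, let $\bar x = (\bar x_1,\ldots,\bar x_N)$ have independent entries of law $P$, let $W = (W_{i_1\ldots i_p})_{1\le i_1,\ldots,i_p\le N}$ and $z = (z_1,\ldots,z_N)$ have independent standard Gaussian entries, and let $\bar x$, $W$, $z$ be independent; write $\mathbb{E}$ for the expectation with respect to $(\bar x, W, z)$. For $t,h\ge 0$ and $x\in\mathbb{R}^N$, set $$H_N(t,h,x) := \frac{\sqrt t}{N^{\frac{p-1}{2}}} \sum_{i_1,\ldots,i_p=1}^N W_{i_1\ldots i_p}x_{i_1}\cdots x_{i_p} + \frac{t}{N^{p-1}}(x\cdot\bar x)^p - \frac{t}{2N^{p-1}}|x|^{2p} + \sqrt h\, z\cdot x + h\, x\cdot\bar x - \frac h2|x|^2,$$ $$F_N(t,h) := \frac1N\log\int_{\mathbb{R}^N} e^{H_N(t,h,x)}\,\mathrm{d}P^{\otimes N}(x), \qquad \bar F_N(t,h) := \mathbb{E}[F_N(t,h)],$$ where $|\cdot|$ is the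 Euclidean norm. Then there exists a constant $C\in(0,\infty)$, depending only on $P$ and $p$, such that for every $N\ge1$ and every $(t,h)\in[0,\infty)^2$, the derivatives below being well defined (one-sided at $t=0$ or $h=0$), $$\partial_h\bar F_N(t,h)\ge0,$$ and $$\left|\partial_t\bar F_N - 2^{p-1}(\partial_h\bar F_N)^p\right|^2 \le \frac CN\,\partial_h^2\bar F_N + C\,\mathbb{E}\left[\left(\partial_hF_N-\partial_h\bar F_N\right)^2\right] + \frac CN\left(\frac1h+\frac1{\sqrt h}\right)$$ at the point $(t,h)$, where the right side is interpreted as $+\infty$ when $h=0$. -/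

import Mathlib

open MeasureTheory ProbabilityTheory

noncomputable section

namespace TensorHJ

/-- The random inputs of the model of order `p` in dimension `N`: a triple `(x̄, W, z)` of the signal
`x̄ ∈ ℝ^N`, the noise tensor `W = (W_{i_1 … i_p})`, and the noise vector `z ∈ ℝ^N`. -/
abbrev Disorder (p N : ℕ) : Type :=
  (Fin N → ℝ) × ((Fin p → Fin N) → ℝ) × (Fin N → ℝ)

/-- The joint law of `(x̄, W, z)`: the three are independent, `x̄` has i.i.d. entries of law `P`, and
`W` and `z` have i.i.d. standard Gaussian entries. -/
def disorderLaw (P : Measure ℝ) (p N : ℕ) : Measure (Disorder p N) :=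
  (Measure.pi fun _ => P).prod
    ((Measure.pi fun _ => gaussianReal 0 1).prod (Measure.pi fun _ => gaussianReal 0 1))

/-- The contraction `W : x^{⊗p} = ∑_{i_1, …, i_p} W_{i_1 … i_p} x_{i_1} ⋯ x_{i_p}`. -/
def tensorContract {p N : ℕ} (W : (Fin p → Fin N) → ℝ) (x : Fin N → ℝ) : ℝ :=
  ∑ i : Fin p → Fin N, W i * ∏ k : Fin p, x (i k)

/-- The enriched Hamiltonian `H_N(t, h, x)`. Here `dotProduct x x` is `|x|²`, so that
`(dotProduct x x) ^ p` is `|x|^{2p}`. -/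
def hamiltonian {p N : ℕ} (ω : Disorder p N) (t h : ℝ) (x : Fin N → ℝ) : ℝ :=
  let xbar := ω.1
  let W := ω.2.1
  let z := ω.2.2
  Real.sqrt t / (N : ℝ) ^ (((p : ℝ) - 1) / 2) * tensorContract W x
    + t / (N : ℝ) ^ ((p : ℝ) - 1) * (dotProduct x xbar) ^ p
    - t / (2 * (N : ℝ) ^ ((p : ℝ) - 1)) * (dotProduct x x) ^ p
    + Real.sqrt h * dotProduct z x + h * dotProduct x xbar - h / 2 * dotProduct x x

/-- The (random) free energy `F_N(t, h) = (1/N) log ∫ e^{H_N(t, h, x)} dP^{⊗N}(x)`. -/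
def freeEnergy (P : Measure ℝ) {p N : ℕ} (ω : Disorder p N) (t h : ℝ) : ℝ :=
  1 / (N : ℝ) *
    Real.log (∫ x : Fin N → ℝ, Real.exp (hamiltonian ω t h x) ∂(Measure.pi fun _ => P))

/-- The averaged free energy `F̄_N(t, h) = 𝔼[F_N(t, h)]`. -/
def meanFreeEnergy (P : Measure ℝ) (p N : ℕ) (t h : ℝ) : ℝ :=
  ∫ ω, freeEnergy P ω t h ∂(disorderLaw P p N)

/-- `∂_t u` for a function `u` on `[0,∞)²`; this is the right derivative at `t = 0`. -/
def partialT (u : ℝ → ℝ → ℝ) (t h : ℝ) : ℝ :=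
  derivWithin (fun s => u s h) (Set.Ici 0) t

/-- `∂_h u` for a function `u` on `[0,∞)²`; this is the right derivative at `h = 0`. -/
def partialH (u : ℝ → ℝ → ℝ) (t h : ℝ) : ℝ :=
  derivWithin (fun k => u t k) (Set.Ici 0) h

end TensorHJ

end

open TensorHJ

/-! The model is a Bayesian inference problem: its Gibbs measure is the conditional law of the signal
`x̄` given a Gaussian observation `y = A(x̄) + g`, where the features `A(x)` consist of the two blocks
`√t x^{⊗p} / N^{(p-1)/2}` and `√h x`. Changing `t` or `h` changes the signal-to-noise ratio `s` of one
block, so both directions are instances of an observation of `√s a + b` with `a` and `b` supported on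
disjoint sets of coordinates (`IsFeatureSplit`). Write `⟨·⟩` for the Gibbs average, `R = a(x) · a(x̄)`
for the overlap and `L = g · a(x) / (2√s) + a(x) · a(x̄) - |a(x)|² / 2` for the score, the derivative in
`s` of the Hamiltonian.

Two identities carry the argument: Gaussian integration by parts (`integral_eval_mul_stdGaussian`,
from Stein's identity), and the Nishimori identity (`nishimori`, from the Cameron–Martin formula).
They give `𝔼⟨L⟩ = 𝔼⟨R⟩ / 2 = 𝔼|⟨a⟩|² / 2` (`integral_score`, `integral_overlap`), which is the first
derivative of the averaged log-partition function and is nonnegative. Hence, with `r = x · x̄ / N`, one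
has `∂_h F̄ = 𝔼⟨r⟩ / 2` and `∂_t F̄ = 𝔼⟨r^p⟩ / 2`, and the difference `∂_t F̄ - 2^{p-1} (∂_h F̄)^p` is
`(𝔼⟨r^p⟩ - (𝔼⟨r⟩)^p) / 2`. As `r` is bounded, its square is at most a constant times the variance of
`r` under `𝔼⟨·⟩` (`sq_integral_overlap_pow_sub_le`).

It remains to bound the variance of `R` in the direction of `h`. They also give
`𝔼⟨R L⟩ = 𝔼⟨R²⟩ - 𝔼[⟨R⟩²] / 2` (`integral_overlap_mul_score`), so that the covariance of `R` and `L` is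
at least half the variance of `R`, and therefore `Var R ≤ 4 Var L`. The variance of `L` splits into its
thermal part `𝔼[⟨L²⟩ - ⟨L⟩²]`, which is the second derivative of the averaged log-partition function up to
`-𝔼⟨∂_s L⟩ ≤ sup |a|² / (4s)`, and the variance of `⟨L⟩` over the disorder, which is that of `N ∂_h F_N`
(`overlap_concentration`). The second derivative also equals
`∑ⱼₖ 𝔼[(⟨aⱼ aₖ⟩ - ⟨aⱼ⟩ ⟨aₖ⟩)²] / 2 ≥ 0`, which makes it harmless to enlarge the constant in front of it.

All integrability and differentiation under the expectation rests on bounds by powers of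
`1 + ∑ |gⱼ|`. To have bounded features everywhere, the coordinates of `x` are truncated to the bounded
support of `P`, which changes the free energy only on a null set of the disorder. -/

namespace TensorHJ

/-! ### Gaussian integration by parts and translation -/

/-- Stein's identity `𝔼[g φ(g)] = 𝔼[φ'(g)]` for a standard Gaussian variable. -/
theorem integral_mul_gaussianReal_eq_integral_deriv {φ φ' : ℝ → ℝ} {B : ℝ}
    (hφ : ∀ x, HasDerivAt φ (φ' x) x) (hB : ∀ x, |φ x| ≤ B) (hB' : ∀ x, |φ' x| ≤ B) :
    ∫ x, x * φ x ∂(gaussianReal 0 1) = ∫ x, φ' x ∂(gaussianReal 0 1) := by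
  have hmφ : Measurable φ :=
    (continuous_iff_continuousAt.2 fun x => (hφ x).continuousAt).measurable
  have hmφ' : Measurable φ' := by
    have : φ' = deriv φ := funext fun x => (hφ x).deriv.symm
    rw [this]; exact measurable_deriv φ
  have h1 : (1 : NNReal) ≠ 0 := one_ne_zero
  have hpdf : ∀ x, HasDerivAt (gaussianPDFReal 0 1) (-x * gaussianPDFReal 0 1 x) x := by
    intro x
    simp only [gaussianPDFReal_def]
    have : HasDerivAt (fun x : ℝ => -(x - 0) ^ 2 / (2 * ((1 : NNReal) : ℝ))) (-x) x := by
      have := ((((hasDerivAt_id x).sub_const 0).pow 2).neg).div_const (2 * ((1 : NNReal) : ℝ))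
      exact this.congr_deriv (by simp; ring)
    exact ((this.exp).const_mul _).congr_deriv (by ring)
  have hint : Integrable (fun x => x * gaussianPDFReal 0 1 x) volume := by
    have := (memLp_id_gaussianReal (μ := 0) (v := 1) 1).integrable (by simp)
    rw [gaussianReal_of_var_ne_zero _ h1, integrable_withDensity_iff_integrable_smul₀'
      (measurable_gaussianPDF _ _).aemeasurable (by simp [gaussianPDF])] at this
    refine this.congr (Filter.Eventually.of_forall fun x => ?_)
    simp [gaussianPDF, gaussianPDFReal_nonneg, mul_comm]
  have key := integral_mul_deriv_eq_deriv_mul_of_integrable (u := φ) (u' := φ')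
    (v := gaussianPDFReal 0 1) (v' := fun x => -x * gaussianPDFReal 0 1 x)
    (fun x _ => hφ x) (fun x _ => hpdf x)
    ((hint.neg.bdd_mul (c := B) hmφ.aestronglyMeasurable
      (Filter.Eventually.of_forall hB)).congr
      (Filter.Eventually.of_forall fun x => by simp))
    ((integrable_gaussianPDFReal 0 1).bdd_mul (c := B) hmφ'.aestronglyMeasurable
      (Filter.Eventually.of_forall hB'))
    ((integrable_gaussianPDFReal 0 1).bdd_mul (c := B) hmφ.aestronglyMeasurable
      (Filter.Eventually.of_forall hB))
  rw [integral_gaussianReal_eq_integral_smul h1, integral_gaussianReal_eq_integral_smul h1]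
  simp only [smul_eq_mul]
  have e1 : (fun x => gaussianPDFReal 0 1 x * (x * φ x))
      = fun x => -(φ x * (-x * gaussianPDFReal 0 1 x)) := by ext x; ring
  rw [e1, integral_neg, key, neg_neg]
  exact integral_congr_ae (Filter.Eventually.of_forall fun x => by simp; ring)

/-- Resampling one coordinate of a product measure independently preserves it. This reduces
Gaussian integration by parts in several variables to the one-dimensional identity. -/
theorem measurePreserving_update_prod {J : Type*} [Fintype J] [DecidableEq J] {E : J → Type*}
    [∀ j, MeasurableSpace (E j)] (ν : ∀ j, Measure (E j)) [∀ j, IsProbabilityMeasure (ν j)]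
    (k : J) :
    MeasurePreserving (fun q : E k × (∀ j, E j) => Function.update q.2 k q.1)
      ((ν k).prod (Measure.pi ν)) (Measure.pi ν) := by
  have hm : Measurable (fun q : E k × (∀ j, E j) => Function.update q.2 k q.1) := by
    rw [measurable_pi_iff]
    intro j
    by_cases hj : j = k
    · subst hj; simpa using measurable_fst
    · simp only [Function.update_of_ne hj]; fun_prop
  refine ⟨hm, (Measure.pi_eq fun s hs => ?_).symm⟩
  rw [Measure.map_apply hm (MeasurableSet.univ_pi hs)]
  have : (fun q : E k × (∀ j, E j) => Function.update q.2 k q.1) ⁻¹' Set.univ.pi s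
      = s k ×ˢ Set.univ.pi (Function.update s k Set.univ) := by
    ext q
    simp only [Set.mem_preimage, Set.mem_pi, Set.mem_univ, forall_const, Set.mem_prod]
    constructor
    · refine fun h => ⟨by simpa using h k, fun j => ?_⟩
      by_cases hj : j = k
      · subst hj; simp
      · simpa [hj] using h j
    · rintro ⟨h1, h2⟩ j
      by_cases hj : j = k
      · subst hj; simpa using h1
      · simpa [hj] using h2 j
  rw [this, Measure.prod_prod, Measure.pi_pi, ← Finset.mul_prod_erase _ _ (Finset.mem_univ k),
    ← Finset.mul_prod_erase _ (fun j => ν j (s j)) (Finset.mem_univ k)]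
  simp only [Function.update_self, measure_univ, one_mul]
  congr 1
  refine Finset.prod_congr rfl fun j hj => ?_
  rw [Function.update_of_ne (Finset.ne_of_mem_erase hj)]

/-- The standard Gaussian measure on `J → ℝ`. -/
noncomputable abbrev stdGaussian (J : Type*) [Fintype J] : Measure (J → ℝ) :=
  Measure.pi fun _ => gaussianReal 0 1

variable {J : Type*} [Fintype J]

/-- Gaussian integration by parts in the coordinate `k`. -/
theorem integral_eval_mul_stdGaussian [DecidableEq J] (k : J) {Φ Φ' : (J → ℝ) → ℝ} {B : ℝ}
    (hΦ : Measurable Φ) (hΦ' : Measurable Φ')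
    (hd : ∀ g u, HasDerivAt (fun u => Φ (Function.update g k u)) (Φ' (Function.update g k u)) u)
    (hB : ∀ g, |Φ g| ≤ B) (hB' : ∀ g, |Φ' g| ≤ B) :
    ∫ g, g k * Φ g ∂(stdGaussian J) = ∫ g, Φ' g ∂(stdGaussian J) := by
  have hmp : MeasurePreserving (fun q : ℝ × (J → ℝ) => Function.update q.2 k q.1)
      ((gaussianReal 0 1).prod (stdGaussian J)) (stdGaussian J) :=
    measurePreserving_update_prod (fun _ : J => gaussianReal 0 1) k
  have hid : Integrable (fun g : J → ℝ => g k) (stdGaussian J) :=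
    integrable_eval ((memLp_id_gaussianReal (μ := 0) (v := 1) 1).integrable (by simp))
  have hi1 : Integrable (fun g => g k * Φ g) (stdGaussian J) :=
    (hid.bdd_mul (c := B) hΦ.aestronglyMeasurable (Filter.Eventually.of_forall hB)).congr
      (Filter.Eventually.of_forall fun g => mul_comm _ _)
  have hi2 : Integrable Φ' (stdGaussian J) :=
    Integrable.of_bound hΦ'.aestronglyMeasurable B (Filter.Eventually.of_forall hB')
  rw [← hmp.map_eq] at hi1 hi2
  have e : ∀ F : (J → ℝ) → ℝ, Integrable F (((gaussianReal 0 1).prod (stdGaussian J)).map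
      (fun q : ℝ × (J → ℝ) => Function.update q.2 k q.1)) →
      ∫ g, F g ∂(stdGaussian J)
        = ∫ g, ∫ u, F (Function.update g k u) ∂(gaussianReal 0 1) ∂(stdGaussian J) := by
    intro F hF
    conv_lhs => rw [← hmp.map_eq]
    rw [integral_map hmp.measurable.aemeasurable hF.aestronglyMeasurable]
    exact integral_prod_symm _ (hF.comp_measurable hmp.measurable)
  rw [e _ hi1, e _ hi2]
  refine integral_congr_ae (Filter.Eventually.of_forall fun g => ?_)
  simp only [Function.update_self]
  exact integral_mul_gaussianReal_eq_integral_deriv (hd g) (fun _ => hB _) (fun _ => hB' _)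

theorem pi_withDensity {E : J → Type*} [∀ j, MeasurableSpace (E j)] (ν : ∀ j, Measure (E j))
    [∀ j, IsProbabilityMeasure (ν j)] {f : ∀ j, E j → ENNReal} (hf : ∀ j, Measurable (f j))
    [∀ j, SigmaFinite ((ν j).withDensity (f j))] :
    Measure.pi (fun j => (ν j).withDensity (f j))
      = (Measure.pi ν).withDensity (fun x => ∏ j, f j (x j)) := by
  refine Measure.pi_eq fun s hs => ?_
  rw [withDensity_apply _ (MeasurableSet.univ_pi hs), ← lintegral_indicator (MeasurableSet.univ_pi hs)]
  have h1 : (Set.univ.pi s).indicator (fun x : ∀ j, E j => ∏ j, f j (x j))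
      = fun x => ∏ j, (s j).indicator (f j) (x j) := by
    ext x
    by_cases hx : x ∈ Set.univ.pi s
    · rw [Set.indicator_of_mem hx]
      exact Finset.prod_congr rfl fun j _ =>
        (Set.indicator_of_mem (hx j (Set.mem_univ j)) _).symm
    · rw [Set.indicator_of_notMem hx]
      simp only [Set.mem_pi, Set.mem_univ, forall_const, not_forall] at hx
      obtain ⟨j, hj⟩ := hx
      exact (Finset.prod_eq_zero (Finset.mem_univ j) (Set.indicator_of_notMem hj _)).symm
  have hind := iIndepFun_pi (μ := ν) (X := fun j => (s j).indicator (f j))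
    (fun j => ((hf j).indicator (hs j)).aemeasurable)
  rw [h1, lintegral_prod_eq_prod_lintegral_of_indepFun Finset.univ _ hind
    (fun j => ((hf j).indicator (hs j)).comp (measurable_pi_apply j))]
  refine Finset.prod_congr rfl fun j _ => ?_
  rw [withDensity_apply _ (hs j), ← lintegral_indicator (hs j)]
  exact ((measurePreserving_eval ν j).lintegral_comp ((hf j).indicator (hs j)))

theorem gaussianReal_eq_withDensity_gaussianReal_zero (m : ℝ) :
    gaussianReal m 1 = (gaussianReal 0 1).withDensity
      (fun x => ENNReal.ofReal (Real.exp (x * m - m ^ 2 / 2))) := by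
  have h1 : (1 : NNReal) ≠ 0 := one_ne_zero
  rw [gaussianReal_of_var_ne_zero _ h1, gaussianReal_of_var_ne_zero _ h1,
    ← withDensity_mul _ (measurable_gaussianPDF _ _) (by fun_prop)]
  congr 1
  ext x
  simp only [gaussianPDF, Pi.mul_apply]
  rw [← ENNReal.ofReal_mul (gaussianPDFReal_nonneg _ _ _)]
  congr 1
  simp only [gaussianPDFReal_def, mul_assoc]
  rw [← Real.exp_add]
  congr 2
  simp
  ring

/-- The Cameron–Martin formula in finite dimension. -/
theorem map_add_stdGaussian (m : J → ℝ) :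
    (stdGaussian J).map (fun g => g + m) = (stdGaussian J).withDensity
      (fun y => ENNReal.ofReal (Real.exp (∑ j, (y j * m j - m j ^ 2 / 2)))) := by
  have h2 : ∀ j, IsProbabilityMeasure ((gaussianReal 0 1).withDensity
      (fun x => ENNReal.ofReal (Real.exp (x * m j - m j ^ 2 / 2)))) := fun j => by
    rw [← gaussianReal_eq_withDensity_gaussianReal_zero]; infer_instance
  have h3 := pi_withDensity (fun _ : J => gaussianReal 0 1)
    (f := fun j x => ENNReal.ofReal (Real.exp (x * m j - m j ^ 2 / 2))) (fun j => by fun_prop)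
  have h4 : ∀ j, IsProbabilityMeasure ((gaussianReal 0 1).map (fun x : ℝ => x + m j)) :=
    fun j => by rw [gaussianReal_map_add_const]; infer_instance
  have h5 := Measure.pi_map_pi (μ := fun _ : J => gaussianReal 0 1) (f := fun j x => x + m j)
    (fun j => by fun_prop)
  have e1 : (fun g : J → ℝ => g + m) = fun g j => g j + m j := rfl
  rw [e1, h5]
  simp only [gaussianReal_map_add_const, zero_add]
  rw [show (fun j => gaussianReal (m j) 1) = fun j => _ from
    funext fun j => gaussianReal_eq_withDensity_gaussianReal_zero (m j), h3]
  congr 1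
  ext y
  rw [Real.exp_sum, ENNReal.ofReal_prod_of_nonneg fun j _ => (Real.exp_pos _).le]

theorem integral_add_stdGaussian (m : J → ℝ) {Φ : (J → ℝ) → ℝ} (hΦ : Measurable Φ) :
    ∫ g, Φ (g + m) ∂(stdGaussian J)
      = ∫ y, Real.exp (∑ j, (y j * m j - m j ^ 2 / 2)) * Φ y ∂(stdGaussian J) := by
  have h := integral_map (μ := stdGaussian J) (φ := fun g => g + m) (f := Φ)
    (by fun_prop) hΦ.aestronglyMeasurable
  rw [← h, map_add_stdGaussian, integral_withDensity_eq_integral_toReal_smul (by fun_prop)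
    (by simp)]
  refine integral_congr_ae (Filter.Eventually.of_forall fun y => ?_)
  simp [ENNReal.toReal_ofReal (Real.exp_pos _).le]

/-! ### Bounded functions and tilted measures -/

/-- A real function which is both bounded and measurable. -/
structure IsBoundedMeasurable {α : Type*} [MeasurableSpace α] (f : α → ℝ) : Prop where
  measurable : Measurable f
  exists_abs_le : ∃ B, ∀ x, |f x| ≤ B

namespace IsBoundedMeasurable

variable {α : Type*} [MeasurableSpace α] {f g : α → ℝ}

theorem const (c : ℝ) : IsBoundedMeasurable fun _ : α => c := ⟨measurable_const, |c|, fun _ => le_rfl⟩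

theorem mul (hf : IsBoundedMeasurable f) (hg : IsBoundedMeasurable g) :
    IsBoundedMeasurable fun x => f x * g x := by
  obtain ⟨B, hB⟩ := hf.exists_abs_le
  obtain ⟨C, hC⟩ := hg.exists_abs_le
  refine ⟨hf.measurable.mul hg.measurable, B * C, fun i => ?_⟩
  rw [abs_mul]
  exact mul_le_mul (hB i) (hC i) (abs_nonneg _) ((abs_nonneg _).trans (hB i))

theorem add (hf : IsBoundedMeasurable f) (hg : IsBoundedMeasurable g) :
    IsBoundedMeasurable fun x => f x + g x := by
  obtain ⟨B, hB⟩ := hf.exists_abs_le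
  obtain ⟨C, hC⟩ := hg.exists_abs_le
  exact ⟨hf.measurable.add hg.measurable, B + C,
    fun i => (abs_add_le _ _).trans (add_le_add (hB i) (hC i))⟩

theorem const_mul (c : ℝ) (hf : IsBoundedMeasurable f) : IsBoundedMeasurable fun x => c * f x :=
  (const c).mul hf

theorem sub (hf : IsBoundedMeasurable f) (hg : IsBoundedMeasurable g) :
    IsBoundedMeasurable fun x => f x - g x := by
  simpa [sub_eq_add_neg] using hf.add (hg.const_mul (-1))

theorem pow (hf : IsBoundedMeasurable f) (n : ℕ) : IsBoundedMeasurable fun x => f x ^ n := by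
  induction n with
  | zero => simpa using const 1
  | succ n ih => simpa only [pow_succ] using ih.mul hf

theorem sum {ι : Type*} (t : Finset ι) {f : ι → α → ℝ} (hf : ∀ i, IsBoundedMeasurable (f i)) :
    IsBoundedMeasurable fun x => ∑ i ∈ t, f i x := by
  classical
  induction t using Finset.induction_on with
  | empty => simpa using const 0
  | insert i t hi ih => simpa [Finset.sum_insert hi] using (hf i).add ih

theorem comp {β : Type*} [MeasurableSpace β] (hf : IsBoundedMeasurable f) {φ : β → α}
    (hφ : Measurable φ) : IsBoundedMeasurable fun x => f (φ x) :=
  ⟨hf.measurable.comp hφ, hf.exists_abs_le.imp fun _ h x => h (φ x)⟩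

theorem integrable {μ : Measure α} [IsFiniteMeasure μ] (hf : IsBoundedMeasurable f) :
    Integrable f μ := by
  obtain ⟨B, hB⟩ := hf.exists_abs_le
  exact Integrable.of_bound hf.measurable.aestronglyMeasurable B (Filter.Eventually.of_forall hB)

theorem integrable_mul {μ : Measure α} (hf : IsBoundedMeasurable f) (hg : Integrable g μ) :
    Integrable (fun x => f x * g x) μ := by
  obtain ⟨B, hB⟩ := hf.exists_abs_le
  exact hg.bdd_mul (c := B) hf.measurable.aestronglyMeasurable (Filter.Eventually.of_forall hB)

theorem sq_integral_le {μ : Measure α} [IsProbabilityMeasure μ] (hf : IsBoundedMeasurable f) :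
    (∫ x, f x ∂μ) ^ 2 ≤ ∫ x, f x ^ 2 ∂μ := by
  have i1 := hf.integrable (μ := μ)
  have i2 := (hf.pow 2).integrable (μ := μ)
  set m := ∫ x, f x ∂μ with hm
  have h0 : 0 ≤ ∫ x, (f x - m) ^ 2 ∂μ := integral_nonneg fun x => sq_nonneg _
  have e : (fun x => (f x - m) ^ 2) = fun x => f x ^ 2 + ((-2 * m) * f x + m ^ 2) := by
    ext x; ring
  have e1 := integral_add i2 ((i1.const_mul (-2 * m)).add (integrable_const (m ^ 2)))
  have e2 := integral_add (i1.const_mul (-2 * m)) (integrable_const (m ^ 2))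
  simp only [Pi.add_apply, integral_const_mul, integral_const, probReal_univ, one_smul] at e1 e2
  rw [e, e1, e2, ← hm] at h0
  nlinarith

end IsBoundedMeasurable

section Tilted

variable {X : Type*} [MeasurableSpace X]

/-- The tilted average as a quotient of two integrals against `μ`. If `exp ∘ h` is not integrable,
both sides are zero. -/
theorem integral_tilted_eq_div (μ : Measure X) (h f : X → ℝ) :
    ∫ x, f x ∂(μ.tilted h) = (∫ x, f x * Real.exp (h x) ∂μ) / ∫ x, Real.exp (h x) ∂μ := by
  rw [integral_tilted, ← integral_div]
  exact integral_congr_ae (Filter.Eventually.of_forall fun x => by simp only [smul_eq_mul]; ring)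

variable {μ : Measure X} [IsProbabilityMeasure μ]

theorem integrable_of_abs_le {f : X → ℝ} {B : ℝ} (hf : Measurable f) (hB : ∀ x, |f x| ≤ B) :
    Integrable f μ :=
  Integrable.of_bound hf.aestronglyMeasurable B (Filter.Eventually.of_forall hB)

theorem abs_integral_le_of_abs_le {f : X → ℝ} {B : ℝ} (hB : ∀ x, |f x| ≤ B) :
    |∫ x, f x ∂μ| ≤ B := by
  have := norm_integral_le_of_norm_le_const (μ := μ) (f := f) (C := B)
    (Filter.Eventually.of_forall hB)
  simpa using this

theorem integrable_exp_of_abs_le {h : X → ℝ} {B : ℝ} (hh : Measurable h) (hB : ∀ x, |h x| ≤ B) :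
    Integrable (fun x => Real.exp (h x)) μ :=
  integrable_of_abs_le (B := Real.exp B) hh.exp fun x => by
    rw [abs_of_pos (Real.exp_pos _)]; exact Real.exp_le_exp.2 ((le_abs_self _).trans (hB x))

theorem abs_log_integral_exp_le {h : X → ℝ} {B : ℝ} (hh : Measurable h) (hB : ∀ x, |h x| ≤ B) :
    |Real.log (∫ x, Real.exp (h x) ∂μ)| ≤ B := by
  have hi := integrable_exp_of_abs_le (μ := μ) hh hB
  have h1 : Real.exp (-B) ≤ ∫ x, Real.exp (h x) ∂μ := by
    have := integral_mono (integrable_const (Real.exp (-B))) hi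
      fun x => Real.exp_le_exp.2 (abs_le.1 (hB x)).1
    simpa using this
  have h2 : ∫ x, Real.exp (h x) ∂μ ≤ Real.exp B := by
    have := integral_mono hi (integrable_const (Real.exp B))
      fun x => Real.exp_le_exp.2 (abs_le.1 (hB x)).2
    simpa using this
  rw [abs_le]
  exact ⟨(Real.le_log_iff_exp_le ((Real.exp_pos _).trans_le h1)).2 h1,
    (Real.log_le_iff_le_exp ((Real.exp_pos _).trans_le h1)).2 h2⟩

theorem hasDerivAt_integral_mul_exp {H H' f f' : ℝ → X → ℝ} {u₀ : ℝ} {s : Set ℝ} {B : ℝ}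
    (hs : s ∈ nhds u₀) (hH : ∀ u, Measurable (H u)) (hH' : Measurable (H' u₀))
    (hf : ∀ u, Measurable (f u)) (hf' : Measurable (f' u₀))
    (hdH : ∀ u ∈ s, ∀ x, HasDerivAt (H · x) (H' u x) u)
    (hdf : ∀ u ∈ s, ∀ x, HasDerivAt (f · x) (f' u x) u)
    (bH : ∀ u ∈ s, ∀ x, |H u x| ≤ B) (bH' : ∀ u ∈ s, ∀ x, |H' u x| ≤ B)
    (bf : ∀ u ∈ s, ∀ x, |f u x| ≤ B) (bf' : ∀ u ∈ s, ∀ x, |f' u x| ≤ B) :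
    HasDerivAt (fun u => ∫ x, f u x * Real.exp (H u x) ∂μ)
      (∫ x, (f' u₀ x + f u₀ x * H' u₀ x) * Real.exp (H u₀ x) ∂μ) u₀ := by
  have hbd : ∀ u ∈ s, ∀ x, |(f' u x + f u x * H' u x) * Real.exp (H u x)|
      ≤ (B + B * B) * Real.exp B := by
    intro u hu x
    rw [abs_mul, abs_of_pos (Real.exp_pos _)]
    have hB : 0 ≤ B := (abs_nonneg _).trans (bH u hu x)
    gcongr
    · refine (abs_add_le _ _).trans (add_le_add (bf' u hu x) ?_)
      rw [abs_mul]
      exact mul_le_mul (bf u hu x) (bH' u hu x) (abs_nonneg _) hB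
    · exact (le_abs_self _).trans (bH u hu x)
  refine (hasDerivAt_integral_of_dominated_loc_of_deriv_le (μ := μ)
    (F := fun u x => f u x * Real.exp (H u x))
    (F' := fun u x => (f' u x + f u x * H' u x) * Real.exp (H u x))
    (bound := fun _ => (B + B * B) * Real.exp B) hs
    (Filter.Eventually.of_forall fun u => ((hf u).mul (hH u).exp).aestronglyMeasurable) ?_
    (((hf'.add ((hf u₀).mul hH')).mul (hH u₀).exp).aestronglyMeasurable)
    (Filter.Eventually.of_forall fun x u hu => hbd u hu x) (integrable_const _)
    (Filter.Eventually.of_forall fun x u hu => ?_)).2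
  · have h0 := mem_of_mem_nhds hs
    exact (integrable_exp_of_abs_le (hH u₀) (bH u₀ h0)).bdd_mul (c := B)
      (hf u₀).aestronglyMeasurable (Filter.Eventually.of_forall (bf u₀ h0))
  · exact ((hdf u hu x).mul (hdH u hu x).exp).congr_deriv (by ring)

theorem hasDerivAt_log_integral_exp {H H' : ℝ → X → ℝ} {u₀ : ℝ} {s : Set ℝ} {B : ℝ}
    (hs : s ∈ nhds u₀) (hH : ∀ u, Measurable (H u)) (hH' : Measurable (H' u₀))
    (hdH : ∀ u ∈ s, ∀ x, HasDerivAt (H · x) (H' u x) u)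
    (bH : ∀ u ∈ s, ∀ x, |H u x| ≤ B) (bH' : ∀ u ∈ s, ∀ x, |H' u x| ≤ B) :
    HasDerivAt (fun u => Real.log (∫ x, Real.exp (H u x) ∂μ))
      (∫ x, H' u₀ x ∂(μ.tilted (H u₀))) u₀ := by
  have h0 := mem_of_mem_nhds hs
  have h := hasDerivAt_integral_mul_exp (μ := μ) (H := H) (H' := H') (f := fun _ _ => 1)
    (f' := fun _ _ => 0) (B := max B 1) hs hH hH' (fun _ => measurable_const) measurable_const hdH
    (fun u _ x => hasDerivAt_const u (1 : ℝ)) (fun u hu x => (bH u hu x).trans (le_max_left _ _))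
    (fun u hu x => (bH' u hu x).trans (le_max_left _ _)) (by simp) (by simp)
  simp only [one_mul, zero_add] at h
  rw [integral_tilted_eq_div]
  exact h.log (integral_exp_pos (integrable_exp_of_abs_le (hH u₀) (bH u₀ h0))).ne'

/-- Differentiation of a Gibbs average along a family of Hamiltonians `H u` with derivative `H' u`:
the derivative of `⟨f⟩` is `⟨f'⟩ + ⟨f H'⟩ - ⟨f⟩ ⟨H'⟩`. -/
theorem hasDerivAt_integral_tilted {H H' f f' : ℝ → X → ℝ} {u₀ : ℝ} {s : Set ℝ} {B : ℝ}
    (hs : s ∈ nhds u₀) (hH : ∀ u, Measurable (H u)) (hH' : Measurable (H' u₀))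
    (hf : ∀ u, Measurable (f u)) (hf' : Measurable (f' u₀))
    (hdH : ∀ u ∈ s, ∀ x, HasDerivAt (H · x) (H' u x) u)
    (hdf : ∀ u ∈ s, ∀ x, HasDerivAt (f · x) (f' u x) u)
    (bH : ∀ u ∈ s, ∀ x, |H u x| ≤ B) (bH' : ∀ u ∈ s, ∀ x, |H' u x| ≤ B)
    (bf : ∀ u ∈ s, ∀ x, |f u x| ≤ B) (bf' : ∀ u ∈ s, ∀ x, |f' u x| ≤ B) :
    HasDerivAt (fun u => ∫ x, f u x ∂(μ.tilted (H u)))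
      (∫ x, f' u₀ x ∂(μ.tilted (H u₀)) + ∫ x, f u₀ x * H' u₀ x ∂(μ.tilted (H u₀))
        - (∫ x, f u₀ x ∂(μ.tilted (H u₀))) * ∫ x, H' u₀ x ∂(μ.tilted (H u₀))) u₀ := by
  have h0 := mem_of_mem_nhds hs
  have hn := hasDerivAt_integral_mul_exp (μ := μ) hs hH hH' hf hf' hdH hdf bH bH' bf bf'
  have hd := hasDerivAt_integral_mul_exp (μ := μ) (H := H) (H' := H') (f := fun _ _ => 1)
    (f' := fun _ _ => 0) (B := max B 1) hs hH hH' (fun _ => measurable_const) measurable_const hdH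
    (fun u _ x => hasDerivAt_const u (1 : ℝ)) (fun u hu x => (bH u hu x).trans (le_max_left _ _))
    (fun u hu x => (bH' u hu x).trans (le_max_left _ _)) (by simp) (by simp)
  simp only [one_mul, zero_add] at hd
  have hZ := (integral_exp_pos (integrable_exp_of_abs_le (μ := μ) (hH u₀) (bH u₀ h0))).ne'
  have hie := integrable_exp_of_abs_le (μ := μ) (hH u₀) (bH u₀ h0)
  have hi1 : Integrable (fun x => f' u₀ x * Real.exp (H u₀ x)) μ :=
    hie.bdd_mul (c := B) hf'.aestronglyMeasurable (Filter.Eventually.of_forall (bf' u₀ h0))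
  have hi2 : Integrable (fun x => f u₀ x * H' u₀ x * Real.exp (H u₀ x)) μ :=
    hie.bdd_mul (c := B * B) ((hf u₀).mul hH').aestronglyMeasurable
      (Filter.Eventually.of_forall fun x => by
        rw [Real.norm_eq_abs, abs_mul]
        exact mul_le_mul (bf u₀ h0 x) (bH' u₀ h0 x) (abs_nonneg _)
          ((abs_nonneg _).trans (bH u₀ h0 x)))
  simp only [integral_tilted_eq_div]
  refine (hn.div hd hZ).congr_deriv ?_
  simp only [add_mul]
  rw [integral_add hi1 hi2]
  field_simp

theorem continuousAt_integral_mul_exp {H f : ℝ → X → ℝ} {u₀ : ℝ} {s : Set ℝ} {B : ℝ}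
    (hs : s ∈ nhds u₀) (hH : ∀ u, Measurable (H u)) (hf : ∀ u, Measurable (f u))
    (hcH : ∀ x, ContinuousAt (H · x) u₀) (hcf : ∀ x, ContinuousAt (f · x) u₀)
    (bH : ∀ u ∈ s, ∀ x, |H u x| ≤ B) (bf : ∀ u ∈ s, ∀ x, |f u x| ≤ B) :
    ContinuousAt (fun u => ∫ x, f u x * Real.exp (H u x) ∂μ) u₀ := by
  refine continuousAt_of_dominated (bound := fun _ => B * Real.exp B)
    (Filter.Eventually.of_forall fun u => ((hf u).mul (hH u).exp).aestronglyMeasurable)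
    (Filter.eventually_of_mem hs fun u hu => Filter.Eventually.of_forall fun x => ?_)
    (integrable_const _)
    (Filter.Eventually.of_forall fun x => (hcf x).mul (hcH x).rexp)
  rw [Real.norm_eq_abs, abs_mul, abs_of_pos (Real.exp_pos _)]
  exact mul_le_mul (bf u hu x) (Real.exp_le_exp.2 ((le_abs_self _).trans (bH u hu x)))
    (Real.exp_pos _).le ((abs_nonneg _).trans (bf u hu x))

theorem continuousAt_log_integral_exp {H : ℝ → X → ℝ} {u₀ : ℝ} {s : Set ℝ} {B : ℝ}
    (hs : s ∈ nhds u₀) (hH : ∀ u, Measurable (H u))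
    (hcH : ∀ x, ContinuousAt (H · x) u₀) (bH : ∀ u ∈ s, ∀ x, |H u x| ≤ B) :
    ContinuousAt (fun u => Real.log (∫ x, Real.exp (H u x) ∂μ)) u₀ := by
  have h0 := mem_of_mem_nhds hs
  have h := continuousAt_integral_mul_exp (μ := μ) (f := fun _ _ => 1) (B := max B 1) hs hH
    (fun _ => measurable_const) hcH (fun _ => continuousAt_const)
    (fun u hu x => (bH u hu x).trans (le_max_left _ _)) (by simp)
  simp only [one_mul] at h
  exact h.log (integral_exp_pos (integrable_exp_of_abs_le (hH u₀) (bH u₀ h0))).ne'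

theorem continuousAt_integral_tilted {H f : ℝ → X → ℝ} {u₀ : ℝ} {s : Set ℝ} {B : ℝ}
    (hs : s ∈ nhds u₀) (hH : ∀ u, Measurable (H u)) (hf : ∀ u, Measurable (f u))
    (hcH : ∀ x, ContinuousAt (H · x) u₀) (hcf : ∀ x, ContinuousAt (f · x) u₀)
    (bH : ∀ u ∈ s, ∀ x, |H u x| ≤ B) (bf : ∀ u ∈ s, ∀ x, |f u x| ≤ B) :
    ContinuousAt (fun u => ∫ x, f u x ∂(μ.tilted (H u))) u₀ := by
  have h0 := mem_of_mem_nhds hs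
  have h := continuousAt_integral_mul_exp (μ := μ) (f := fun _ _ => 1) (B := max B 1) hs hH
    (fun _ => measurable_const) hcH (fun _ => continuousAt_const)
    (fun u hu x => (bH u hu x).trans (le_max_left _ _)) (by simp)
  simp only [one_mul] at h
  simp only [integral_tilted_eq_div]
  exact (continuousAt_integral_mul_exp hs hH hf hcH hcf bH bf).div h
    (integral_exp_pos (integrable_exp_of_abs_le (hH u₀) (bH u₀ h0))).ne'

end Tilted

section Observation

/-! ### Gibbs measures of Gaussian observations -/

/-- `Φ` is bounded and measurable, and has the bounded measurable `k`-th partial derivative `Φ'`. -/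
structure HasBoundedPartial {J : Type*} [DecidableEq J] (k : J) (Φ Φ' : (J → ℝ) → ℝ) : Prop where
  self : IsBoundedMeasurable Φ
  partial' : IsBoundedMeasurable Φ'
  hasDerivAt : ∀ y u, HasDerivAt (fun u => Φ (Function.update y k u)) (Φ' (Function.update y k u)) u

theorem HasBoundedPartial.mul {J : Type*} [DecidableEq J] {k : J} {Φ Φ' Ψ Ψ' : (J → ℝ) → ℝ}
    (h : HasBoundedPartial k Φ Φ') (h' : HasBoundedPartial k Ψ Ψ') :
    HasBoundedPartial k (fun y => Φ y * Ψ y) (fun y => Φ' y * Ψ y + Φ y * Ψ' y) where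
  self := h.self.mul h'.self
  partial' := (h.partial'.mul h'.self).add (h.self.mul h'.partial')
  hasDerivAt y u := (h.hasDerivAt y u).mul (h'.hasDerivAt y u)

theorem HasBoundedPartial.sub {J : Type*} [DecidableEq J] {k : J} {Φ Φ' Ψ Ψ' : (J → ℝ) → ℝ}
    (h : HasBoundedPartial k Φ Φ') (h' : HasBoundedPartial k Ψ Ψ') :
    HasBoundedPartial k (fun y => Φ y - Ψ y) (fun y => Φ' y - Ψ' y) where
  self := h.self.sub h'.self
  partial' := h.partial'.sub h'.partial'
  hasDerivAt y u := (h.hasDerivAt y u).sub (h'.hasDerivAt y u)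

variable {X : Type*} {J : Type*} [Fintype J]

/-- The log-likelihood, relative to the standard Gaussian law of the noise, of the signal `x` given
the observation `y = A x + noise`. -/
noncomputable def energy (A : X → J → ℝ) (y : J → ℝ) (x : X) : ℝ :=
  ∑ j, (y j * A x j - A x j ^ 2 / 2)

theorem abs_energy_le {A : X → J → ℝ} {M : ℝ} (hM : ∀ x j, |A x j| ≤ M) (y : J → ℝ) (x : X) :
    |energy A y x| ≤ ∑ j, (|y j| * M + M ^ 2 / 2) := by
  refine (Finset.abs_sum_le_sum_abs _ _).trans (Finset.sum_le_sum fun j _ => ?_)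
  refine (abs_sub _ _).trans (add_le_add ?_ ?_)
  · rw [abs_mul]; exact mul_le_mul_of_nonneg_left (hM x j) (abs_nonneg _)
  · rw [abs_of_nonneg (by positivity), ← sq_abs]
    have := hM x j
    gcongr

/-- The energy is affine in each coordinate of the observation. -/
theorem energy_update [DecidableEq J] (A : X → J → ℝ) (y : J → ℝ) (k : J) (u : ℝ) (x : X) :
    energy A (Function.update y k u) x = energy A (Function.update y k 0) x + u * A x k := by
  unfold energy
  rw [← Finset.add_sum_erase _ _ (Finset.mem_univ k),
    ← Finset.add_sum_erase _ (fun j => Function.update y k 0 j * A x j - A x j ^ 2 / 2)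
      (Finset.mem_univ k)]
  have : ∀ v, ∑ j ∈ Finset.univ.erase k, (Function.update y k v j * A x j - A x j ^ 2 / 2)
      = ∑ j ∈ Finset.univ.erase k, (y j * A x j - A x j ^ 2 / 2) := fun v =>
    Finset.sum_congr rfl fun j hj => by
      rw [Function.update_of_ne (Finset.ne_of_mem_erase hj)]
  rw [this, this]
  simp only [Function.update_self]
  ring

variable [MeasurableSpace X]

/-- The Gibbs average of `f`, which is its posterior expectation given the observation `y`. -/
noncomputable def gibbs (μ : Measure X) (A : X → J → ℝ) (y : J → ℝ) (f : X → ℝ) : ℝ :=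
  ∫ x, f x ∂(μ.tilted (energy A y))

/-- The joint law of the signal and of the Gaussian noise. -/
noncomputable abbrev signalNoise (μ : Measure X) (J : Type*) [Fintype J] :
    Measure (X × (J → ℝ)) :=
  μ.prod (stdGaussian J)

theorem measurable_energy {A : X → J → ℝ} (hA : Measurable A) :
    Measurable fun q : (J → ℝ) × X => energy A q.1 q.2 := by
  unfold energy
  have : ∀ j, Measurable fun x => A x j := fun j => (measurable_pi_apply j).comp hA
  fun_prop

theorem measurable_energy_right {A : X → J → ℝ} (hA : Measurable A) (y : J → ℝ) :
    Measurable (energy A y) :=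
  (measurable_energy hA).comp measurable_prodMk_left

variable {μ : Measure X} [IsProbabilityMeasure μ] {A : X → J → ℝ} {M : ℝ}

theorem isProbabilityMeasure_tilted_energy (hA : Measurable A) (hM : ∀ x j, |A x j| ≤ M)
    (y : J → ℝ) : IsProbabilityMeasure (μ.tilted (energy A y)) :=
  isProbabilityMeasure_tilted
    (integrable_exp_of_abs_le (measurable_energy_right hA y) (abs_energy_le hM y))

theorem abs_gibbs_le (hA : Measurable A) (hM : ∀ x j, |A x j| ≤ M) (y : J → ℝ) {f : X → ℝ} {B : ℝ}
    (hB : ∀ x, |f x| ≤ B) : |gibbs μ A y f| ≤ B := by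
  have := isProbabilityMeasure_tilted_energy (μ := μ) hA hM y
  exact abs_integral_le_of_abs_le hB

theorem measurable_gibbs {Ω : Type*} [MeasurableSpace Ω] (hA : Measurable A) {y : Ω → J → ℝ}
    (hy : Measurable y) {f : Ω → X → ℝ} (hf : Measurable (Function.uncurry f)) :
    Measurable fun ω => gibbs μ A (y ω) (f ω) := by
  have he : Measurable fun q : Ω × X => Real.exp (energy A (y q.1) q.2) :=
    ((measurable_energy hA).comp ((hy.comp measurable_fst).prodMk measurable_snd)).exp
  simp only [gibbs, integral_tilted_eq_div]
  exact (StronglyMeasurable.integral_prod_right'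
      (f := fun q : Ω × X => f q.1 q.2 * Real.exp (energy A (y q.1) q.2))
      (hf.mul he).stronglyMeasurable).measurable.div
    (StronglyMeasurable.integral_prod_right' he.stronglyMeasurable).measurable

theorem measurable_log_integral_exp_energy {Ω : Type*} [MeasurableSpace Ω] (hA : Measurable A)
    {y : Ω → J → ℝ} (hy : Measurable y) :
    Measurable fun ω => Real.log (∫ x, Real.exp (energy A (y ω) x) ∂μ) := by
  have he : Measurable fun q : Ω × X => Real.exp (energy A (y q.1) q.2) :=
    ((measurable_energy hA).comp ((hy.comp measurable_fst).prodMk measurable_snd)).exp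
  exact (StronglyMeasurable.integral_prod_right' he.stronglyMeasurable).measurable.log

theorem IsBoundedMeasurable.gibbs (hA : Measurable A) (hM : ∀ x j, |A x j| ≤ M) {f : X → ℝ}
    (hf : IsBoundedMeasurable f) : IsBoundedMeasurable fun y => gibbs μ A y f :=
  ⟨measurable_gibbs hA measurable_id (f := fun _ => f) (hf.measurable.comp measurable_snd),
    hf.exists_abs_le.imp fun _ hB y => abs_gibbs_le hA hM y hB⟩

omit [Fintype J] in
theorem IsBoundedMeasurable.eval (hA : Measurable A) (hM : ∀ x j, |A x j| ≤ M) (k : J) :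
    IsBoundedMeasurable fun x => A x k :=
  ⟨(measurable_pi_apply k).comp hA, M, fun x => hM x k⟩

/-- `∂ₖ⟨f⟩ = ⟨f Aₖ⟩ - ⟨f⟩ ⟨Aₖ⟩`, the derivative being taken in the `k`-th coordinate of the
observation. -/
theorem hasBoundedPartial_gibbs [DecidableEq J] (hA : Measurable A) (hM : ∀ x j, |A x j| ≤ M)
    (k : J) {f : X → ℝ} (hf : IsBoundedMeasurable f) :
    HasBoundedPartial k (fun y => TensorHJ.gibbs μ A y f)
      (fun y => TensorHJ.gibbs μ A y (fun x => f x * A x k)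
        - TensorHJ.gibbs μ A y f * TensorHJ.gibbs μ A y (fun x => A x k)) := by
  have hAk := IsBoundedMeasurable.eval hA hM k
  refine ⟨hf.gibbs hA hM, ((hf.mul hAk).gibbs hA hM).sub ((hf.gibbs hA hM).mul (hAk.gibbs hA hM)),
    fun y u => ?_⟩
  obtain ⟨B, hB⟩ := hf.exists_abs_le
  set E : ℝ := ∑ j, (|Function.update y k 0 j| * M + M ^ 2 / 2)
  have hEb : ∀ v ∈ Set.Ioo (u - 1) (u + 1), ∀ x,
      |energy A (Function.update y k v) x| ≤ E + (|u| + 1) * M := by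
    intro v hv x
    rw [energy_update]
    refine (abs_add_le _ _).trans (add_le_add (abs_energy_le hM _ x) ?_)
    rw [abs_mul]
    have : |v| ≤ |u| + 1 := by
      have := abs_sub_abs_le_abs_sub v u
      have h2 : |v - u| ≤ 1 := abs_le.2 ⟨by linarith [hv.1], by linarith [hv.2]⟩
      linarith
    exact mul_le_mul this (hM x k) (abs_nonneg _) (by positivity)
  have hd := hasDerivAt_integral_tilted (μ := μ)
    (H := fun v => energy A (Function.update y k v)) (H' := fun _ x => A x k)
    (f := fun _ => f) (f' := fun _ _ => 0) (u₀ := u) (s := Set.Ioo (u - 1) (u + 1))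
    (B := max (E + (|u| + 1) * M) (max M (max B 0))) (Ioo_mem_nhds (by simp) (by simp))
    (fun v => measurable_energy_right hA _) hAk.measurable (fun _ => hf.measurable)
    measurable_const
    (fun v _ x => by
      have e : (fun v => energy A (Function.update y k v) x)
          = fun v => energy A (Function.update y k 0) x + v * A x k :=
        funext fun v => energy_update A y k v x
      rw [e]
      exact (((hasDerivAt_id v).mul_const (A x k)).const_add _).congr_deriv (by simp))
    (fun v _ x => hasDerivAt_const v (f x))
    (fun v hv x => (hEb v hv x).trans (le_max_left _ _))
    (fun v _ x => (hM x k).trans (le_max_of_le_right (le_max_left _ _)))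
    (fun v _ x => (hB x).trans (le_max_of_le_right (le_max_of_le_right (le_max_left _ _))))
    (by simp)
  exact hd.congr_deriv (by simp [TensorHJ.gibbs])

theorem integrable_noise (k : J) : Integrable (fun ω => ω.2 k) (signalNoise μ J) :=
  (integrable_eval (μ := fun _ : J => gaussianReal 0 1) (i := k)
    ((memLp_id_gaussianReal (μ := 0) (v := 1) 1).integrable (by simp))).comp_snd μ

omit [Fintype J] in
theorem IsBoundedMeasurable.observation (hA : Measurable A) {Φ : (J → ℝ) → ℝ}
    (hΦ : IsBoundedMeasurable Φ) :
    IsBoundedMeasurable fun ω : X × (J → ℝ) => Φ (ω.2 + A ω.1) :=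
  hΦ.comp (measurable_snd.add (hA.comp measurable_fst))

/-- Gaussian integration by parts under the joint law of signal and noise, for a function of the
observation multiplied by a weight depending only on the signal. -/
theorem HasBoundedPartial.integral_eval_mul [DecidableEq J] {k : J} {Φ Φ' : (J → ℝ) → ℝ}
    (h : HasBoundedPartial k Φ Φ') (hA : Measurable A) {w : X → ℝ} (hw : IsBoundedMeasurable w) :
    ∫ ω, ω.2 k * (w ω.1 * Φ (ω.2 + A ω.1)) ∂(signalNoise μ J)
      = ∫ ω, w ω.1 * Φ' (ω.2 + A ω.1) ∂(signalNoise μ J) := by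
  have hw' := hw.comp (measurable_fst (β := J → ℝ))
  have hi : Integrable (fun ω => ω.2 k * (w ω.1 * Φ (ω.2 + A ω.1))) (signalNoise μ J) := by
    simpa only [mul_comm] using
      (hw'.mul (h.self.observation hA)).integrable_mul (integrable_noise (μ := μ) k)
  have hi' : Integrable (fun ω => w ω.1 * Φ' (ω.2 + A ω.1)) (signalNoise μ J) :=
    (hw'.mul (h.partial'.observation hA)).integrable
  obtain ⟨B, hB⟩ := h.self.exists_abs_le
  obtain ⟨B', hB'⟩ := h.partial'.exists_abs_le
  rw [integral_prod _ hi, integral_prod _ hi']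
  refine integral_congr_ae (Filter.Eventually.of_forall fun x => ?_)
  have := integral_eval_mul_stdGaussian k (Φ := fun g => Φ (g + A x)) (Φ' := fun g => Φ' (g + A x))
    (B := max B B') (h.self.measurable.comp (by fun_prop))
    (h.partial'.measurable.comp (by fun_prop))
    (fun g u => by
      have e : ∀ v, Function.update g k v + A x = Function.update (g + A x) k (v + A x k) := by
        intro v; ext j
        by_cases hj : j = k
        · subst hj; simp
        · simp [hj]
      simp only [e]
      exact (h.hasDerivAt (g + A x) (u + A x k)).comp_add_const u (A x k))
    (fun g => (hB _).trans (le_max_left _ _)) (fun g => (hB' _).trans (le_max_right _ _))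
  have e1 : ∀ g : J → ℝ, g k * (w x * Φ (g + A x)) = w x * (g k * Φ (g + A x)) := fun g => by ring
  simp only [e1]
  rw [integral_const_mul, integral_const_mul, this]

/-! ### The Nishimori identity -/

/-- The likelihood is dominated by `∏ⱼ (exp (M yⱼ) + exp (-M yⱼ))`, uniformly in the signal. -/
theorem integrable_exp_energy (hA : Measurable A) (hM : ∀ x j, |A x j| ≤ M) :
    Integrable (fun q : X × (J → ℝ) => Real.exp (energy A q.2 q.1)) (μ.prod (stdGaussian J)) := by
  have hm : Measurable fun q : X × (J → ℝ) => Real.exp (energy A q.2 q.1) :=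
    ((measurable_energy hA).comp (measurable_snd.prodMk measurable_fst)).exp
  have h1 : Integrable (fun y : J → ℝ => ∏ j, (Real.exp (M * y j) + Real.exp (-M * y j)))
      (stdGaussian J) :=
    Integrable.fintype_prod (μ := fun _ : J => gaussianReal 0 1)
      (f := fun _ v => Real.exp (M * v) + Real.exp (-M * v)) fun j =>
      (integrable_exp_mul_gaussianReal M).add (integrable_exp_mul_gaussianReal (-M))
  refine (h1.comp_snd μ).mono' hm.aestronglyMeasurable (Filter.Eventually.of_forall fun q => ?_)
  rw [Real.norm_eq_abs, abs_of_pos (Real.exp_pos _), energy, Real.exp_sum]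
  refine Finset.prod_le_prod (fun _ _ => (Real.exp_pos _).le) fun j _ => ?_
  have hj := hM q.1 j
  have h2 : q.2 j * A q.1 j ≤ |q.2 j| * M := (le_abs_self _).trans (by
    rw [abs_mul]; exact mul_le_mul_of_nonneg_left hj (abs_nonneg _))
  have h3 : Real.exp (q.2 j * A q.1 j - A q.1 j ^ 2 / 2) ≤ Real.exp (|q.2 j| * M) :=
    Real.exp_le_exp.2 (by nlinarith [sq_nonneg (A q.1 j)])
  refine h3.trans ?_
  rcases abs_cases (q.2 j) with ⟨h, _⟩ | ⟨h, _⟩ <;> rw [h]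
  · rw [mul_comm]; exact le_add_of_nonneg_right (Real.exp_pos _).le
  · rw [neg_mul_comm, mul_comm]; exact le_add_of_nonneg_left (Real.exp_pos _).le

/-- The joint law of the signal and the observation has density `exp (energy A y x)` with respect
to the product of the law of the signal and the standard Gaussian measure. -/
theorem integral_signal_mul_observation (hA : Measurable A) (hM : ∀ x j, |A x j| ≤ M)
    {f : X → ℝ} (hf : IsBoundedMeasurable f) {Φ : (J → ℝ) → ℝ} (hΦ : IsBoundedMeasurable Φ) :
    ∫ ω, f ω.1 * Φ (ω.2 + A ω.1) ∂(signalNoise μ J)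
      = ∫ y, Φ y * ∫ x, f x * Real.exp (energy A y x) ∂μ ∂(stdGaussian J) := by
  have hi : Integrable (fun ω : X × (J → ℝ) => f ω.1 * Φ (ω.2 + A ω.1)) (signalNoise μ J) :=
    ((hf.comp measurable_fst).mul (hΦ.observation hA)).integrable
  have hi2 : Integrable (fun q : X × (J → ℝ) =>
      (f q.1 * Φ q.2) * Real.exp (energy A q.2 q.1)) (μ.prod (stdGaussian J)) :=
    ((hf.comp measurable_fst).mul (hΦ.comp measurable_snd)).integrable_mul
      (integrable_exp_energy hA hM)
  rw [integral_prod _ hi]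
  simp only [integral_const_mul, integral_add_stdGaussian _ hΦ.measurable]
  have e1 : ∀ x, f x * ∫ y, Real.exp (∑ j, (y j * A x j - A x j ^ 2 / 2)) * Φ y ∂(stdGaussian J)
      = ∫ y, (f x * Φ y) * Real.exp (energy A y x) ∂(stdGaussian J) := fun x => by
    rw [← integral_const_mul]
    exact integral_congr_ae (Filter.Eventually.of_forall fun y => by simp only [energy]; ring)
  simp only [e1]
  rw [integral_integral_swap hi2]
  refine integral_congr_ae (Filter.Eventually.of_forall fun y => ?_)
  simp only
  rw [← integral_const_mul]
  exact integral_congr_ae (Filter.Eventually.of_forall fun x => by simp only; ring)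

/-- The Nishimori identity: next to a function of the observation, the signal may be replaced by a
sample from the Gibbs measure, since the latter is the conditional law of the signal. -/
theorem nishimori (hA : Measurable A) (hM : ∀ x j, |A x j| ≤ M)
    {f : X → ℝ} (hf : IsBoundedMeasurable f) {Φ : (J → ℝ) → ℝ} (hΦ : IsBoundedMeasurable Φ) :
    ∫ ω, f ω.1 * Φ (ω.2 + A ω.1) ∂(signalNoise μ J)
      = ∫ ω, gibbs μ A (ω.2 + A ω.1) f * Φ (ω.2 + A ω.1) ∂(signalNoise μ J) := by
  have h2 := integral_signal_mul_observation (μ := μ) hA hM (IsBoundedMeasurable.const 1)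
    (Φ := fun y => gibbs μ A y f * Φ y) ((hf.gibbs hA hM).mul hΦ)
  simp only [one_mul] at h2
  rw [h2, integral_signal_mul_observation hA hM hf hΦ]
  refine integral_congr_ae (Filter.Eventually.of_forall fun y => ?_)
  have hZ := (integral_exp_pos (integrable_exp_of_abs_le (μ := μ)
    (measurable_energy_right hA y) (abs_energy_le hM y))).ne'
  simp only [gibbs, integral_tilted_eq_div]
  field_simp

end Observation

/-! ### Observation with a varying signal-to-noise ratio -/

section Path

set_option linter.unusedSectionVars false

variable {X : Type*} {J : Type*} [Fintype J]

/-- The feature map `√s a + b`, whose first part is observed with signal-to-noise ratio `s`. -/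
noncomputable def featurePath (a b : X → J → ℝ) (s : ℝ) (x : X) (j : J) : ℝ :=
  √s * a x j + b x j

/-- The Hamiltonian of the observation of `√s a + b`, where `ω` is the pair of the signal and the
noise. -/
noncomputable def pathEnergy (a b : X → J → ℝ) (s : ℝ) (ω : X × (J → ℝ)) (x : X) : ℝ :=
  energy (featurePath a b s) (ω.2 + featurePath a b s ω.1) x

/-- The derivative in `s` of `pathEnergy a b s ω x` at `s > 0`. -/
noncomputable def score (a : X → J → ℝ) (s : ℝ) (ω : X × (J → ℝ)) (x : X) : ℝ :=
  ∑ j, (ω.2 j * a x j / (2 * √s) + (a ω.1 j * a x j - a x j ^ 2 / 2))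

/-- The second derivative in `s` of `pathEnergy a b s ω x` at `s > 0`. -/
noncomputable def scoreDeriv (a : X → J → ℝ) (s : ℝ) (ω : X × (J → ℝ)) (x : X) : ℝ :=
  ∑ j, -(ω.2 j * a x j / (4 * s * √s))

/-- The size `1 + ∑ |g_j|` of the noise, in terms of which all quantities are bounded. -/
noncomputable def noiseSize (ω : X × (J → ℝ)) : ℝ := 1 + ∑ j, |ω.2 j|

theorem one_le_noiseSize (ω : X × (J → ℝ)) : 1 ≤ noiseSize ω :=
  le_add_of_nonneg_right (Finset.sum_nonneg fun _ _ => abs_nonneg _)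

theorem sum_le_mul_noiseSize {c d : ℝ} (hc : 0 ≤ c) (hd : 0 ≤ d) (ω : X × (J → ℝ)) :
    ∑ j, (|ω.2 j| * c + d) ≤ (c + Fintype.card J * d) * noiseSize ω := by
  rw [Finset.sum_add_distrib, ← Finset.sum_mul]
  simp only [Finset.sum_const, Finset.card_univ, nsmul_eq_mul, noiseSize]
  have h : 0 ≤ ∑ j, |ω.2 j| := Finset.sum_nonneg fun _ _ => abs_nonneg _
  have h2 : 0 ≤ (Fintype.card J : ℝ) * d := by positivity
  nlinarith [mul_nonneg h2 h]

variable [MeasurableSpace X]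

/-- The features `a` and `b` are measurable, bounded by `M`, and supported on disjoint sets of
coordinates. -/
structure IsFeatureSplit (a b : X → J → ℝ) (M : ℝ) : Prop where
  measurable_left : Measurable a
  measurable_right : Measurable b
  nonneg : 0 ≤ M
  abs_left_le : ∀ x j, |a x j| ≤ M
  abs_right_le : ∀ x j, |b x j| ≤ M
  disjoint : ∀ j, (∀ x, a x j = 0) ∨ (∀ x, b x j = 0)

namespace IsFeatureSplit

variable {a b : X → J → ℝ} {M : ℝ} (h : IsFeatureSplit a b M)
include h

theorem measurable_featurePath (s : ℝ) : Measurable (featurePath a b s) := by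
  have h1 := h.measurable_left
  have h2 := h.measurable_right
  rw [measurable_pi_iff] at h1 h2 ⊢
  exact fun j => ((h1 j).const_mul _).add (h2 j)

theorem abs_featurePath_le (s : ℝ) (x : X) (j : J) :
    |featurePath a b s x j| ≤ (√s + 1) * M := by
  refine (abs_add_le _ _).trans ?_
  rw [abs_mul, abs_of_nonneg (Real.sqrt_nonneg s), add_mul, one_mul]
  exact add_le_add (mul_le_mul_of_nonneg_left (h.abs_left_le x j) (Real.sqrt_nonneg s))
    (h.abs_right_le x j)

theorem measurable_observation (s : ℝ) :
    Measurable fun ω : X × (J → ℝ) => ω.2 + featurePath a b s ω.1 :=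
  measurable_snd.add ((h.measurable_featurePath s).comp measurable_fst)

theorem measurable_pathEnergy (s : ℝ) (ω : X × (J → ℝ)) : Measurable (pathEnergy a b s ω) :=
  measurable_energy_right (h.measurable_featurePath s) _

theorem abs_pathEnergy_le {s S : ℝ} (hs : s ≤ S) (ω : X × (J → ℝ)) (x : X) :
    |pathEnergy a b s ω x|
      ≤ ((√S + 1) * M + Fintype.card J * (2 * ((√S + 1) * M) ^ 2)) * noiseSize ω := by
  have hm : (√s + 1) * M ≤ (√S + 1) * M :=
    mul_le_mul_of_nonneg_right (by linarith [Real.sqrt_le_sqrt hs]) h.nonneg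
  have h0 : 0 ≤ (√S + 1) * M := mul_nonneg (by positivity) h.nonneg
  have hA : ∀ x j, |featurePath a b s x j| ≤ (√S + 1) * M :=
    fun x j => (h.abs_featurePath_le s x j).trans hm
  refine (abs_energy_le hA _ x).trans (le_trans (Finset.sum_le_sum fun j _ => ?_)
    (sum_le_mul_noiseSize h0 (d := 2 * ((√S + 1) * M) ^ 2) (by positivity) ω))
  have h1 : |(ω.2 + featurePath a b s ω.1) j| ≤ |ω.2 j| + (√S + 1) * M :=
    (abs_add_le _ _).trans (add_le_add_right (hA ω.1 j) _)
  nlinarith [mul_le_mul_of_nonneg_right h1 h0]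

theorem measurable_eval_left (j : J) : Measurable fun x => a x j :=
  (measurable_pi_apply j).comp h.measurable_left

theorem measurable_uncurry_score (s : ℝ) : Measurable (Function.uncurry (score a s)) := by
  unfold score Function.uncurry
  have := h.measurable_eval_left
  fun_prop

theorem measurable_uncurry_scoreDeriv (s : ℝ) :
    Measurable (Function.uncurry (scoreDeriv a s)) := by
  unfold scoreDeriv Function.uncurry
  have := h.measurable_eval_left
  fun_prop

theorem measurable_score (s : ℝ) (ω : X × (J → ℝ)) : Measurable (score a s ω) :=
  (h.measurable_uncurry_score s).comp measurable_prodMk_left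

theorem measurable_scoreDeriv (s : ℝ) (ω : X × (J → ℝ)) : Measurable (scoreDeriv a s ω) :=
  (h.measurable_uncurry_scoreDeriv s).comp measurable_prodMk_left

theorem abs_score_le {r s : ℝ} (hr : 0 < r) (hrs : r ≤ s) (ω : X × (J → ℝ)) (x : X) :
    |score a s ω x| ≤ (M / (2 * √r) + Fintype.card J * (2 * M ^ 2)) * noiseSize ω := by
  have hM := h.nonneg
  have hsr : 0 < √r := Real.sqrt_pos.2 hr
  have hss : √r ≤ √s := Real.sqrt_le_sqrt hrs
  have hqs : 0 < √s := hsr.trans_le hss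
  refine (Finset.abs_sum_le_sum_abs _ _).trans (le_trans (Finset.sum_le_sum fun j _ => ?_)
    (sum_le_mul_noiseSize (by positivity) (d := 2 * M ^ 2) (by positivity) ω))
  have ha := h.abs_left_le x j
  have hx := h.abs_left_le ω.1 j
  refine (abs_add_le _ _).trans (add_le_add ?_ ((abs_sub _ _).trans ?_))
  · rw [abs_div, abs_mul, mul_div_assoc, abs_of_pos (a := 2 * √s) (by positivity)]
    gcongr
  · rw [abs_mul, abs_of_nonneg (by positivity : 0 ≤ a x j ^ 2 / 2), ← sq_abs (a x j)]
    nlinarith [mul_le_mul hx ha (abs_nonneg _) hM, mul_self_le_mul_self (abs_nonneg _) ha,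
      sq_nonneg M]

theorem abs_scoreDeriv_le {r s : ℝ} (hr : 0 < r) (hrs : r ≤ s) (ω : X × (J → ℝ)) (x : X) :
    |scoreDeriv a s ω x| ≤ M / (4 * r * √r) * noiseSize ω := by
  have hM := h.nonneg
  have hsr : 0 < √r := Real.sqrt_pos.2 hr
  have hss : √r ≤ √s := Real.sqrt_le_sqrt hrs
  have hs := hr.trans_le hrs
  have hqs : 0 < √s := hsr.trans_le hss
  refine (Finset.abs_sum_le_sum_abs _ _).trans (le_trans (Finset.sum_le_sum fun j _ => ?_)
    ((sum_le_mul_noiseSize (c := M / (4 * r * √r)) (by positivity) le_rfl ω).trans_eq (by rw [mul_zero, add_zero])))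
  have ha := h.abs_left_le x j
  rw [abs_neg, abs_div, abs_mul, mul_div_assoc, add_zero,
    abs_of_pos (a := 4 * s * √s) (by positivity)]
  gcongr

/-- The mixed terms in `a` and `b` vanish, so that the dependence on `s` is through `√s` and `s`
only. The hypothesis `0 ≤ s` is needed for `√s ^ 2 = s`. -/
theorem pathEnergy_eq {s : ℝ} (hs : 0 ≤ s) (ω : X × (J → ℝ)) (x : X) :
    pathEnergy a b s ω x = ∑ j, (√s * (ω.2 j * a x j) + s * (a ω.1 j * a x j - a x j ^ 2 / 2)
      + (ω.2 j * b x j + (b ω.1 j * b x j - b x j ^ 2 / 2))) := by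
  refine Finset.sum_congr rfl fun j _ => ?_
  simp only [featurePath, Pi.add_apply]
  have hsq := Real.sq_sqrt hs
  rcases h.disjoint j with h0 | h0 <;> simp only [h0]
  · ring
  · linear_combination (a ω.1 j * a x j - a x j ^ 2 / 2) * hsq

theorem hasDerivAt_pathEnergy {s : ℝ} (hs : 0 < s) (ω : X × (J → ℝ)) (x : X) :
    HasDerivAt (fun s => pathEnergy a b s ω x) (score a s ω x) s := by
  have e : (fun s => pathEnergy a b s ω x) =ᶠ[nhds s] fun s =>
      ∑ j, (√s * (ω.2 j * a x j) + s * (a ω.1 j * a x j - a x j ^ 2 / 2)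
        + (ω.2 j * b x j + (b ω.1 j * b x j - b x j ^ 2 / 2))) :=
    Filter.eventually_of_mem (Ioi_mem_nhds hs) fun s hs => h.pathEnergy_eq (le_of_lt hs) ω x
  refine HasDerivAt.congr_of_eventuallyEq ?_ e
  refine HasDerivAt.fun_sum fun j _ => ?_
  exact ((((Real.hasDerivAt_sqrt hs.ne').mul_const _).add
    ((hasDerivAt_id s).mul_const _)).add_const _).congr_deriv (by ring)

omit h [MeasurableSpace X] in
theorem hasDerivAt_score {s : ℝ} (hs : 0 < s) (ω : X × (J → ℝ)) (x : X) :
    HasDerivAt (fun s => score a s ω x) (scoreDeriv a s ω x) s := by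
  refine HasDerivAt.fun_sum fun j _ => ?_
  have hq : 0 < √s := Real.sqrt_pos.2 hs
  refine (((hasDerivAt_const s (ω.2 j * a x j)).div
    ((Real.hasDerivAt_sqrt hs.ne').const_mul 2) (by positivity)).add_const _).congr_deriv ?_
  have hsq := Real.sq_sqrt hs.le
  field_simp
  rw [hsq]
  ring

omit h [MeasurableSpace X] in
theorem continuous_pathEnergy (ω : X × (J → ℝ)) (x : X) :
    Continuous fun s => pathEnergy a b s ω x := by
  unfold pathEnergy energy featurePath
  simp only [Pi.add_apply]
  fun_prop

end IsFeatureSplit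

variable {μ : Measure X}

/-- The average of `f` under the Gibbs measure of the observation of `√s a + b`. -/
noncomputable def pathGibbs (μ : Measure X) (a b : X → J → ℝ) (s : ℝ) (ω : X × (J → ℝ))
    (f : X → ℝ) : ℝ :=
  gibbs μ (featurePath a b s) (ω.2 + featurePath a b s ω.1) f

/-- The log-partition function of the observation of `√s a + b`. -/
noncomputable def pathLog (μ : Measure X) (a b : X → J → ℝ) (s : ℝ) (ω : X × (J → ℝ)) : ℝ :=
  Real.log (∫ x, Real.exp (pathEnergy a b s ω x) ∂μ)

namespace IsFeatureSplit

variable [IsProbabilityMeasure μ] {a b : X → J → ℝ} {M : ℝ} (h : IsFeatureSplit a b M)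
include h

theorem measurable_pathGibbs (s : ℝ) {f : X × (J → ℝ) → X → ℝ}
    (hf : Measurable (Function.uncurry f)) : Measurable fun ω => pathGibbs μ a b s ω (f ω) :=
  measurable_gibbs (h.measurable_featurePath s) (h.measurable_observation s) hf

theorem measurable_pathGibbs_const (s : ℝ) {f : X → ℝ}
    (hf : Measurable f) : Measurable fun ω => pathGibbs μ a b s ω f :=
  h.measurable_pathGibbs s (f := fun _ => f) (hf.comp measurable_snd)

theorem measurable_pathLog (s : ℝ) : Measurable fun ω => pathLog μ a b s ω :=
  measurable_log_integral_exp_energy (h.measurable_featurePath s) (h.measurable_observation s)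

theorem abs_pathGibbs_le (s : ℝ) (ω : X × (J → ℝ)) {f : X → ℝ} {B : ℝ} (hB : ∀ x, |f x| ≤ B) :
    |pathGibbs μ a b s ω f| ≤ B :=
  abs_gibbs_le (h.measurable_featurePath s) (h.abs_featurePath_le s) _ hB

theorem hasDerivAt_pathLog {s : ℝ} (hs : 0 < s) (ω : X × (J → ℝ)) :
    HasDerivAt (fun s => pathLog μ a b s ω) (pathGibbs μ a b s ω (score a s ω)) s :=
  hasDerivAt_log_integral_exp (μ := μ) (H := fun s => pathEnergy a b s ω)
    (H' := fun s => score a s ω) (s := Set.Ioo (s / 2) (2 * s))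
    (B := max _ _) (Ioo_mem_nhds (by linarith) (by linarith))
    (fun s => h.measurable_pathEnergy s ω) (h.measurable_score s ω)
    (fun u hu x => h.hasDerivAt_pathEnergy ((half_pos hs).trans hu.1) ω x)
    (fun u hu x => (h.abs_pathEnergy_le hu.2.le ω x).trans (le_max_left _ _))
    (fun u hu x => (h.abs_score_le (half_pos hs) hu.1.le ω x).trans (le_max_right _ _))

theorem hasDerivAt_pathGibbs {s : ℝ} (hs : 0 < s) (ω : X × (J → ℝ)) {f : X → ℝ} {B : ℝ}
    (hf : Measurable f) (hB : ∀ x, |f x| ≤ B) :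
    HasDerivAt (fun s => pathGibbs μ a b s ω f) (pathGibbs μ a b s ω (fun x => f x * score a s ω x)
      - pathGibbs μ a b s ω f * pathGibbs μ a b s ω (score a s ω)) s := by
  have hd := hasDerivAt_integral_tilted (μ := μ) (H := fun s => pathEnergy a b s ω)
    (H' := fun s => score a s ω) (f := fun _ => f) (f' := fun _ _ => 0)
    (s := Set.Ioo (s / 2) (2 * s)) (u₀ := s)
    (B := max _ (max _ (max B 0))) (Ioo_mem_nhds (by linarith) (by linarith))
    (fun s => h.measurable_pathEnergy s ω) (h.measurable_score s ω)
    (fun _ => hf) measurable_const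
    (fun u hu x => h.hasDerivAt_pathEnergy ((half_pos hs).trans hu.1) ω x)
    (fun u _ x => hasDerivAt_const u (f x))
    (fun u hu x => (h.abs_pathEnergy_le hu.2.le ω x).trans (le_max_left _ _))
    (fun u hu x => (h.abs_score_le (half_pos hs) hu.1.le ω x).trans
      (le_max_of_le_right (le_max_left _ _)))
    (fun u _ x => (hB x).trans (le_max_of_le_right (le_max_of_le_right (le_max_left _ _))))
    (by simp)
  exact hd.congr_deriv (by simp only [integral_zero, zero_add]; rfl)

theorem hasDerivAt_pathGibbs_score {s : ℝ} (hs : 0 < s) (ω : X × (J → ℝ)) :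
    HasDerivAt (fun s => pathGibbs μ a b s ω (score a s ω))
      (pathGibbs μ a b s ω (scoreDeriv a s ω) + pathGibbs μ a b s ω (fun x => score a s ω x ^ 2)
      - pathGibbs μ a b s ω (score a s ω) ^ 2) s := by
  have hd := hasDerivAt_integral_tilted (μ := μ) (H := fun s => pathEnergy a b s ω)
    (H' := fun s => score a s ω) (f := fun s => score a s ω) (f' := fun s => scoreDeriv a s ω)
    (s := Set.Ioo (s / 2) (2 * s)) (u₀ := s)
    (B := max _ (max _ _)) (Ioo_mem_nhds (by linarith) (by linarith))
    (fun s => h.measurable_pathEnergy s ω) (h.measurable_score s ω)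
    (fun s => h.measurable_score s ω) (h.measurable_scoreDeriv s ω)
    (fun u hu x => h.hasDerivAt_pathEnergy ((half_pos hs).trans hu.1) ω x)
    (fun u hu x => hasDerivAt_score ((half_pos hs).trans hu.1) ω x)
    (fun u hu x => (h.abs_pathEnergy_le hu.2.le ω x).trans (le_max_left _ _))
    (fun u hu x => (h.abs_score_le (half_pos hs) hu.1.le ω x).trans
      (le_max_of_le_right (le_max_left _ _)))
    (fun u hu x => (h.abs_score_le (half_pos hs) hu.1.le ω x).trans
      (le_max_of_le_right (le_max_left _ _)))
    (fun u hu x => (h.abs_scoreDeriv_le (half_pos hs) hu.1.le ω x).trans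
      (le_max_of_le_right (le_max_right _ _)))
  exact hd.congr_deriv (by simp only [← sq]; rfl)

theorem continuous_pathLog (ω : X × (J → ℝ)) : Continuous fun s => pathLog μ a b s ω :=
  continuous_iff_continuousAt.2 fun s =>
    continuousAt_log_integral_exp (Iio_mem_nhds (lt_add_one s))
      (fun s => h.measurable_pathEnergy s ω)
      (fun x => (continuous_pathEnergy ω x).continuousAt)
      (fun _ hu x => h.abs_pathEnergy_le (le_of_lt hu) ω x)

theorem continuous_pathGibbs (ω : X × (J → ℝ)) {f : X → ℝ} {B : ℝ}
    (hf : Measurable f) (hB : ∀ x, |f x| ≤ B) : Continuous fun s => pathGibbs μ a b s ω f :=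
  continuous_iff_continuousAt.2 fun s =>
    continuousAt_integral_tilted (B := max _ _) (Iio_mem_nhds (lt_add_one s))
      (fun s => h.measurable_pathEnergy s ω) (fun _ => hf)
      (fun x => (continuous_pathEnergy ω x).continuousAt) (fun _ => continuousAt_const)
      (fun _ hu x => (h.abs_pathEnergy_le (le_of_lt hu) ω x).trans (le_max_left _ _))
      (fun _ _ x => (hB x).trans (le_max_right _ _))

end IsFeatureSplit

end Path

/-! ### Averages over the disorder -/

section DisorderAverages

variable {X : Type*} [MeasurableSpace X] {J : Type*} [Fintype J] {μ : Measure X}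
  [IsProbabilityMeasure μ]

theorem IsBoundedMeasurable.noise_mul {F : X × (J → ℝ) → ℝ} (hF : IsBoundedMeasurable F) (k : J) :
    Integrable (fun ω => ω.2 k * F ω) (signalNoise μ J) := by
  simpa only [mul_comm] using hF.integrable_mul (integrable_noise (μ := μ) k)

theorem integrable_noiseSize_sq :
    Integrable (fun ω => noiseSize ω ^ 2) (signalNoise μ J) := by
  have h1 : ∀ j : J, MemLp (fun g : J → ℝ => |g j|) 2 (stdGaussian J) := fun j =>
    (((memLp_id_gaussianReal (μ := 0) (v := 1) 2).comp_measurePreserving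
      (measurePreserving_eval (fun _ : J => gaussianReal 0 1) j))).abs
  have h2 : MemLp (fun g : J → ℝ => 1 + ∑ j, |g j|) 2 (stdGaussian J) :=
    (memLp_const (1 : ℝ)).add (memLp_finsetSum _ fun j _ => h1 j)
  exact h2.integrable_sq.comp_snd μ

theorem integrable_of_abs_le_noiseSize_sq {F : X × (J → ℝ) → ℝ} (hF : Measurable F) {c : ℝ}
    (hc : ∀ ω, |F ω| ≤ c * noiseSize ω ^ 2) : Integrable F (signalNoise μ J) :=
  (integrable_noiseSize_sq.const_mul c).mono' hF.aestronglyMeasurable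
    (Filter.Eventually.of_forall hc)

omit [MeasurableSpace X] in
theorem mul_noiseSize_le {c : ℝ} (hc : 0 ≤ c) (ω : X × (J → ℝ)) :
    c * noiseSize ω ≤ c * noiseSize ω ^ 2 :=
  mul_le_mul_of_nonneg_left (by nlinarith [one_le_noiseSize ω]) hc

/-- The overlap `a(x) · a(x̄)` of `x` with the signal. -/
noncomputable def overlap (a : X → J → ℝ) (ω : X × (J → ℝ)) (x : X) : ℝ :=
  ∑ j, a ω.1 j * a x j

namespace IsFeatureSplit

variable {a b : X → J → ℝ} {M : ℝ} (h : IsFeatureSplit a b M)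
include h

omit [Fintype J] in
theorem eval_left (j : J) : IsBoundedMeasurable fun x => a x j :=
  .eval h.measurable_left h.abs_left_le j

omit [Fintype J] in
theorem signal_left (j : J) : IsBoundedMeasurable fun ω : X × (J → ℝ) => a ω.1 j :=
  (h.eval_left j).comp measurable_fst

theorem pathGibbs_bounded (s : ℝ) {f : X → ℝ} (hf : IsBoundedMeasurable f) :
    IsBoundedMeasurable fun ω => pathGibbs μ a b s ω f :=
  (hf.gibbs (h.measurable_featurePath s) (h.abs_featurePath_le s)).observation
    (h.measurable_featurePath s)

theorem isProbabilityMeasure_path (s : ℝ) (ω : X × (J → ℝ)) :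
    IsProbabilityMeasure (μ.tilted (pathEnergy a b s ω)) :=
  isProbabilityMeasure_tilted_energy (h.measurable_featurePath s) (h.abs_featurePath_le s) _

theorem score_bounded {s : ℝ} (hs : 0 < s) (ω : X × (J → ℝ)) :
    IsBoundedMeasurable (score a s ω) :=
  ⟨h.measurable_score s ω, _, h.abs_score_le hs le_rfl ω⟩

theorem overlap_bounded (ω : X × (J → ℝ)) : IsBoundedMeasurable (overlap a ω) :=
  .sum _ fun j => (h.eval_left j).const_mul _

theorem measurable_uncurry_overlap : Measurable (Function.uncurry (overlap (J := J) a)) := by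
  unfold overlap Function.uncurry
  have := h.measurable_eval_left
  fun_prop

theorem abs_overlap_le (ω : X × (J → ℝ)) (x : X) :
    |overlap a ω x| ≤ Fintype.card J * M ^ 2 := by
  refine (Finset.abs_sum_le_sum_abs _ _).trans ((Finset.sum_le_sum fun j _ => ?_).trans_eq
    (b := ∑ _j : J, M ^ 2) (by simp))
  rw [abs_mul, sq]
  exact mul_le_mul (h.abs_left_le _ j) (h.abs_left_le _ j) (abs_nonneg _) h.nonneg

theorem pathGibbs_sum (s : ℝ) (ω : X × (J → ℝ)) {f : J → X → ℝ}
    (hf : ∀ j, IsBoundedMeasurable (f j)) :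
    pathGibbs μ a b s ω (fun x => ∑ j, f j x) = ∑ j, pathGibbs μ a b s ω (f j) := by
  have := h.isProbabilityMeasure_path (μ := μ) s ω
  exact integral_finsetSum _ fun j _ => (hf j).integrable

omit h [IsProbabilityMeasure μ] in
theorem pathGibbs_const_mul (s : ℝ) (ω : X × (J → ℝ)) (c : ℝ) (f : X → ℝ) :
    pathGibbs μ a b s ω (fun x => c * f x) = c * pathGibbs μ a b s ω f :=
  integral_const_mul _ _

theorem pathGibbs_overlap (s : ℝ) (ω : X × (J → ℝ)) :
    pathGibbs μ a b s ω (overlap a ω)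
      = ∑ j, a ω.1 j * pathGibbs μ a b s ω (fun x => a x j) := by
  unfold overlap
  rw [h.pathGibbs_sum s ω fun j => (h.eval_left j).const_mul _]
  simp only [pathGibbs_const_mul]

theorem pathGibbs_mul_score (s : ℝ) (ω : X × (J → ℝ)) {f : X → ℝ} (hf : IsBoundedMeasurable f) :
    pathGibbs μ a b s ω (fun x => f x * score a s ω x)
      = ∑ k, (ω.2 k * pathGibbs μ a b s ω (fun x => f x * a x k) / (2 * √s)
        + (a ω.1 k * pathGibbs μ a b s ω (fun x => f x * a x k)
          - pathGibbs μ a b s ω (fun x => f x * a x k ^ 2) / 2)) := by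
  have := h.isProbabilityMeasure_path (μ := μ) s ω
  have h1 : ∀ k, IsBoundedMeasurable fun x => f x * a x k := fun k => hf.mul (h.eval_left k)
  have h2 : ∀ k, IsBoundedMeasurable fun x => f x * a x k ^ 2 :=
    fun k => hf.mul ((h.eval_left k).pow 2)
  have e : (fun x => f x * score a s ω x) = fun x => ∑ k, ((ω.2 k / (2 * √s)) * (f x * a x k)
      + (a ω.1 k * (f x * a x k) - (1 / 2) * (f x * a x k ^ 2))) := by
    ext x
    rw [score, Finset.mul_sum]
    exact Finset.sum_congr rfl fun k _ => by ring
  rw [e, h.pathGibbs_sum s ω fun k =>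
    ((h1 k).const_mul _).add (((h1 k).const_mul _).sub ((h2 k).const_mul _))]
  refine Finset.sum_congr rfl fun k _ => ?_
  have i1 := ((h1 k).const_mul (ω.2 k / (2 * √s))).integrable (μ := μ.tilted (pathEnergy a b s ω))
  have i2 := ((h1 k).const_mul (a ω.1 k)).integrable (μ := μ.tilted (pathEnergy a b s ω))
  have i3 := ((h2 k).const_mul (1 / 2)).integrable (μ := μ.tilted (pathEnergy a b s ω))
  have : pathGibbs μ a b s ω (fun x => (ω.2 k / (2 * √s)) * (f x * a x k)
      + (a ω.1 k * (f x * a x k) - (1 / 2) * (f x * a x k ^ 2)))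
      = ω.2 k / (2 * √s) * pathGibbs μ a b s ω (fun x => f x * a x k)
        + (a ω.1 k * pathGibbs μ a b s ω (fun x => f x * a x k)
          - (1 / 2) * pathGibbs μ a b s ω (fun x => f x * a x k ^ 2)) := by
    simp only [← pathGibbs_const_mul]
    exact (integral_add i1 (i2.sub i3)).trans (congrArg _ (integral_sub i2 i3))
  rw [this]
  ring

theorem pathGibbs_score (s : ℝ) (ω : X × (J → ℝ)) :
    pathGibbs μ a b s ω (score a s ω)
      = ∑ k, (ω.2 k * pathGibbs μ a b s ω (fun x => a x k) / (2 * √s)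
        + (a ω.1 k * pathGibbs μ a b s ω (fun x => a x k)
          - pathGibbs μ a b s ω (fun x => a x k ^ 2) / 2)) := by
  simpa only [one_mul] using h.pathGibbs_mul_score (μ := μ) s ω (IsBoundedMeasurable.const 1)

theorem pathGibbs_scoreDeriv (s : ℝ) (ω : X × (J → ℝ)) :
    pathGibbs μ a b s ω (scoreDeriv a s ω)
      = ∑ k, -(ω.2 k * pathGibbs μ a b s ω (fun x => a x k) / (4 * s * √s)) := by
  have e : scoreDeriv a s ω = fun x => ∑ k, -(ω.2 k / (4 * s * √s)) * a x k := by
    ext x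
    exact Finset.sum_congr rfl fun k _ => by ring
  rw [e, h.pathGibbs_sum s ω fun k => (h.eval_left k).const_mul _]
  simp only [pathGibbs_const_mul]
  exact Finset.sum_congr rfl fun k _ => by ring

theorem nishimori_path (s : ℝ) {f : X → ℝ} (hf : IsBoundedMeasurable f) {Φ : (J → ℝ) → ℝ}
    (hΦ : IsBoundedMeasurable Φ) :
    ∫ ω, f ω.1 * Φ (ω.2 + featurePath a b s ω.1) ∂(signalNoise μ J)
      = ∫ ω, pathGibbs μ a b s ω f * Φ (ω.2 + featurePath a b s ω.1) ∂(signalNoise μ J) :=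
  nishimori (h.measurable_featurePath s) (h.abs_featurePath_le s) hf hΦ

theorem gibbs_bounded (s : ℝ) {f : X → ℝ} (hf : IsBoundedMeasurable f) :
    IsBoundedMeasurable fun y => gibbs μ (featurePath a b s) y f :=
  hf.gibbs (h.measurable_featurePath s) (h.abs_featurePath_le s)

/-- In a coordinate `k` where `b` vanishes, the feature is `√s aₖ`. -/
theorem hasBoundedPartial_path [DecidableEq J] (s : ℝ) {k : J} (hb : ∀ x, b x k = 0) {f : X → ℝ}
    (hf : IsBoundedMeasurable f) :
    HasBoundedPartial k (fun y => gibbs μ (featurePath a b s) y f)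
      (fun y => √s * (gibbs μ (featurePath a b s) y (fun x => f x * a x k)
        - gibbs μ (featurePath a b s) y f * gibbs μ (featurePath a b s) y (fun x => a x k))) := by
  convert hasBoundedPartial_gibbs (μ := μ) (h.measurable_featurePath s) (h.abs_featurePath_le s)
    k hf using 2 with y
  have e : ∀ x, featurePath a b s x k = √s * a x k := fun x => by
    rw [featurePath, hb, add_zero]
  have e2 : (fun x => f x * (√s * a x k)) = fun x => √s * (f x * a x k) := by
    ext x; ring
  simp only [e]
  rw [e2]
  simp only [gibbs, integral_const_mul]
  ring

/-- `𝔼[gₖ w(x̄) ⟨f aₖ⟩] = √s 𝔼[w(x̄) (⟨f aₖ²⟩ - ⟨f aₖ⟩ ⟨aₖ⟩)]`. In the coordinates where `a` vanishes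
both sides are zero; in the others `b` vanishes and integration by parts applies. -/
theorem integral_noise_mul_gibbs (s : ℝ) (k : J) {w f : X → ℝ} (hw : IsBoundedMeasurable w)
    (hf : IsBoundedMeasurable f) :
    ∫ ω, ω.2 k * (w ω.1 * pathGibbs μ a b s ω (fun x => f x * a x k)) ∂(signalNoise μ J)
      = √s * ∫ ω, w ω.1 * (pathGibbs μ a b s ω (fun x => f x * a x k ^ 2)
          - pathGibbs μ a b s ω (fun x => f x * a x k)
            * pathGibbs μ a b s ω (fun x => a x k)) ∂(signalNoise μ J) := by
  classical
  rcases h.disjoint k with h0 | h0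
  · simp [h0, pathGibbs, gibbs]
  · have := (h.hasBoundedPartial_path (μ := μ) s h0 (hf.mul (h.eval_left k))).integral_eval_mul
      (μ := μ) (h.measurable_featurePath s) hw
    refine this.trans ?_
    rw [← integral_const_mul]
    refine integral_congr_ae (Filter.Eventually.of_forall fun ω => ?_)
    have e : (fun x => f x * a x k ^ 2) = fun x => f x * a x k * a x k := by ext x; ring
    simp only [pathGibbs, e]
    ring

/-- Integration by parts for `gₖ ⟨f⟩ Cₖ`, where `Cₖ = ⟨f aₖ⟩ - ⟨f⟩ ⟨aₖ⟩`; the derivative of `Cₖ` is a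
third cumulant. -/
theorem integral_noise_mul_gibbs_covariance (s : ℝ) (k : J) {f : X → ℝ}
    (hf : IsBoundedMeasurable f) :
    ∫ ω, ω.2 k * (pathGibbs μ a b s ω f * (pathGibbs μ a b s ω (fun x => f x * a x k)
          - pathGibbs μ a b s ω f * pathGibbs μ a b s ω (fun x => a x k))) ∂(signalNoise μ J)
      = √s * ∫ ω, ((pathGibbs μ a b s ω (fun x => f x * a x k)
            - pathGibbs μ a b s ω f * pathGibbs μ a b s ω (fun x => a x k)) ^ 2
          + pathGibbs μ a b s ω f * (pathGibbs μ a b s ω (fun x => f x * a x k ^ 2)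
            - pathGibbs μ a b s ω f * pathGibbs μ a b s ω (fun x => a x k ^ 2)
            - 2 * pathGibbs μ a b s ω (fun x => a x k)
              * (pathGibbs μ a b s ω (fun x => f x * a x k)
            - pathGibbs μ a b s ω f * pathGibbs μ a b s ω (fun x => a x k)))) ∂(signalNoise μ J) := by
  classical
  rcases h.disjoint k with h0 | h0
  · simp [h0, pathGibbs, gibbs]
  · have p1 := h.hasBoundedPartial_path (μ := μ) s h0 hf
    have p2 := h.hasBoundedPartial_path (μ := μ) s h0 (hf.mul (h.eval_left k))
    have p3 := h.hasBoundedPartial_path (μ := μ) s h0 (h.eval_left k)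
    have := (p1.mul (p2.sub (p1.mul p3))).integral_eval_mul (μ := μ)
      (h.measurable_featurePath s) (IsBoundedMeasurable.const 1)
    simp only [one_mul] at this
    refine this.trans ?_
    rw [← integral_const_mul]
    refine integral_congr_ae (Filter.Eventually.of_forall fun ω => ?_)
    have e : (fun x => f x * a x k ^ 2) = fun x => f x * a x k * a x k := by ext x; ring
    have e2 : (fun x => a x k ^ 2) = fun x => a x k * a x k := by ext x; ring
    simp only [pathGibbs, e, e2]
    ring

/-- Integration by parts removes the noise from `𝔼[w(x̄) ⟨f L⟩]`, where `L` is the score. The terms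
`⟨f aₖ²⟩` that it produces cancel those coming from `-|a|² / 2`. -/
theorem integral_mul_gibbs_mul_score {s : ℝ} (hs : 0 < s) {w f : X → ℝ}
    (hw : IsBoundedMeasurable w) (hf : IsBoundedMeasurable f) :
    Integrable (fun ω => w ω.1 * pathGibbs μ a b s ω (fun x => f x * score a s ω x))
      (signalNoise μ J) ∧
    ∫ ω, w ω.1 * pathGibbs μ a b s ω (fun x => f x * score a s ω x) ∂(signalNoise μ J)
      = ∑ k, (∫ ω, w ω.1 * (a ω.1 k * pathGibbs μ a b s ω (fun x => f x * a x k))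
            ∂(signalNoise μ J)
          - 1 / 2 * ∫ ω, w ω.1 * (pathGibbs μ a b s ω (fun x => f x * a x k)
            * pathGibbs μ a b s ω (fun x => a x k)) ∂(signalNoise μ J)) := by
  have hq : 0 < √s := Real.sqrt_pos.2 hs
  have hw' := hw.comp (measurable_fst (β := J → ℝ))
  have g1 : ∀ k, IsBoundedMeasurable fun ω => pathGibbs μ a b s ω (fun x => f x * a x k) :=
    fun k => h.pathGibbs_bounded s (hf.mul (h.eval_left k))
  have g2 : ∀ k, IsBoundedMeasurable fun ω => pathGibbs μ a b s ω (fun x => f x * a x k ^ 2) :=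
    fun k => h.pathGibbs_bounded s (hf.mul ((h.eval_left k).pow 2))
  have g3 : ∀ k, IsBoundedMeasurable fun ω => pathGibbs μ a b s ω (fun x => a x k) :=
    fun k => h.pathGibbs_bounded s (h.eval_left k)
  have e : (fun ω => w ω.1 * pathGibbs μ a b s ω (fun x => f x * score a s ω x))
      = fun ω => ∑ k, ((1 / (2 * √s)) * (ω.2 k * (w ω.1 *
          pathGibbs μ a b s ω (fun x => f x * a x k)))
        + (w ω.1 * (a ω.1 k * pathGibbs μ a b s ω (fun x => f x * a x k))
          - (1 / 2) * (w ω.1 * pathGibbs μ a b s ω (fun x => f x * a x k ^ 2)))) := by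
    ext ω
    rw [h.pathGibbs_mul_score s ω hf, Finset.mul_sum]
    exact Finset.sum_congr rfl fun k _ => by ring
  have i1 : ∀ k, Integrable (fun ω => (1 / (2 * √s)) * (ω.2 k * (w ω.1 *
      pathGibbs μ a b s ω (fun x => f x * a x k)))) (signalNoise μ J) := fun k =>
    ((hw'.mul (g1 k)).noise_mul k).const_mul _
  have i2 : ∀ k, Integrable (fun ω => w ω.1 * (a ω.1 k *
      pathGibbs μ a b s ω (fun x => f x * a x k))) (signalNoise μ J) := fun k =>
    (hw'.mul ((h.signal_left k).mul (g1 k))).integrable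
  have i3 : ∀ k, Integrable (fun ω => (1 / 2) * (w ω.1 *
      pathGibbs μ a b s ω (fun x => f x * a x k ^ 2))) (signalNoise μ J) := fun k =>
    (hw'.mul (g2 k)).integrable.const_mul _
  have i4 : ∀ k, Integrable (fun ω => w ω.1 * (pathGibbs μ a b s ω (fun x => f x * a x k) *
      pathGibbs μ a b s ω (fun x => a x k))) (signalNoise μ J) := fun k =>
    (hw'.mul ((g1 k).mul (g3 k))).integrable
  rw [e]
  refine ⟨integrable_finsetSum _ fun k _ => (i1 k).add ((i2 k).sub (i3 k)), ?_⟩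
  refine (integral_finsetSum _ fun k _ => (i1 k).add ((i2 k).sub (i3 k))).trans
    (Finset.sum_congr rfl fun k _ => ?_)
  have hsub : ∫ ω, w ω.1 * (pathGibbs μ a b s ω (fun x => f x * a x k ^ 2)
          - pathGibbs μ a b s ω (fun x => f x * a x k)
            * pathGibbs μ a b s ω (fun x => a x k)) ∂(signalNoise μ J)
      = ∫ ω, w ω.1 * pathGibbs μ a b s ω (fun x => f x * a x k ^ 2) ∂(signalNoise μ J)
        - ∫ ω, w ω.1 * (pathGibbs μ a b s ω (fun x => f x * a x k)
            * pathGibbs μ a b s ω (fun x => a x k)) ∂(signalNoise μ J) := by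
    rw [← integral_sub (hw'.mul (g2 k)).integrable (i4 k)]
    exact integral_congr_ae (Filter.Eventually.of_forall fun ω => by simp only; ring)
  refine ((integral_add (i1 k) ((i2 k).sub (i3 k))).trans
    (congrArg _ (integral_sub (i2 k) (i3 k)))).trans ?_
  rw [integral_const_mul, integral_const_mul, h.integral_noise_mul_gibbs s k hw hf, hsub]
  field_simp
  ring

/-- `𝔼⟨a(x) · a(x̄)⟩ = 𝔼|⟨a⟩|²`, by the Nishimori identity. -/
theorem integral_overlap (s : ℝ) :
    ∫ ω, pathGibbs μ a b s ω (overlap a ω) ∂(signalNoise μ J)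
      = ∑ j, ∫ ω, pathGibbs μ a b s ω (fun x => a x j) ^ 2 ∂(signalNoise μ J) := by
  simp only [h.pathGibbs_overlap]
  rw [integral_finsetSum _ fun j _ =>
    ((h.signal_left j).mul (h.pathGibbs_bounded s (h.eval_left j))).integrable]
  refine Finset.sum_congr rfl fun j _ => ?_
  refine (h.nishimori_path s (h.eval_left j) (h.gibbs_bounded s (h.eval_left j))).trans ?_
  exact integral_congr_ae (Filter.Eventually.of_forall fun ω => by
    simp only [pathGibbs]; ring)

/-- `𝔼⟨L⟩ = 𝔼⟨R⟩ / 2`, where `L` is the score and `R` the overlap. -/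
theorem integral_score {s : ℝ} (hs : 0 < s) :
    Integrable (fun ω => pathGibbs μ a b s ω (score a s ω)) (signalNoise μ J) ∧
    ∫ ω, pathGibbs μ a b s ω (score a s ω) ∂(signalNoise μ J)
      = 1 / 2 * ∫ ω, pathGibbs μ a b s ω (overlap a ω) ∂(signalNoise μ J) := by
  have := h.integral_mul_gibbs_mul_score (μ := μ) hs (IsBoundedMeasurable.const 1)
    (IsBoundedMeasurable.const 1)
  simp only [one_mul] at this
  refine ⟨this.1, this.2.trans ?_⟩
  rw [Finset.sum_sub_distrib, ← Finset.mul_sum]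
  have e1 : ∑ k, ∫ ω, a ω.1 k * pathGibbs μ a b s ω (fun x => a x k) ∂(signalNoise μ J)
      = ∫ ω, pathGibbs μ a b s ω (overlap a ω) ∂(signalNoise μ J) := by
    simp only [h.pathGibbs_overlap]
    rw [integral_finsetSum _ fun j _ =>
      ((h.signal_left j).mul (h.pathGibbs_bounded s (h.eval_left j))).integrable]
  have e2 := h.integral_overlap (μ := μ) s
  simp only [sq] at e2
  rw [e1, ← e2]
  ring

/-- `𝔼⟨R L⟩ = 𝔼⟨R²⟩ - 𝔼[⟨R⟩²] / 2`, where `L` is the score and `R` the overlap. Together with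
`𝔼⟨L⟩ = 𝔼⟨R⟩ / 2` it shows that the covariance of `R` and `L` is at least half the variance of `R`. -/
theorem integral_overlap_mul_score {s : ℝ} (hs : 0 < s) :
    Integrable (fun ω => pathGibbs μ a b s ω (fun x => overlap a ω x * score a s ω x))
      (signalNoise μ J) ∧
    ∫ ω, pathGibbs μ a b s ω (fun x => overlap a ω x * score a s ω x) ∂(signalNoise μ J)
      = ∫ ω, pathGibbs μ a b s ω (fun x => overlap a ω x ^ 2) ∂(signalNoise μ J)
        - 1 / 2 * ∫ ω, pathGibbs μ a b s ω (overlap a ω) ^ 2 ∂(signalNoise μ J) := by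
  have key := fun j => h.integral_mul_gibbs_mul_score (μ := μ) hs (h.eval_left j) (h.eval_left j)
  have e : ∀ ω, pathGibbs μ a b s ω (fun x => overlap a ω x * score a s ω x)
      = ∑ j, a ω.1 j * pathGibbs μ a b s ω (fun x => a x j * score a s ω x) := by
    intro ω
    simp only [← pathGibbs_const_mul]
    rw [← h.pathGibbs_sum s ω fun j => ((h.eval_left j).mul (h.score_bounded hs ω)).const_mul _]
    congr 1
    ext x
    rw [overlap, Finset.sum_mul]
    exact Finset.sum_congr rfl fun j _ => by ring
  have bb : ∀ j k, IsBoundedMeasurable fun ω => pathGibbs μ a b s ω (fun x => a x j * a x k) :=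
    fun j k => h.pathGibbs_bounded s ((h.eval_left j).mul (h.eval_left k))
  have b1 : ∀ j, IsBoundedMeasurable fun ω => pathGibbs μ a b s ω (fun x => a x j) :=
    fun j => h.pathGibbs_bounded s (h.eval_left j)
  have e2 : ∫ ω, pathGibbs μ a b s ω (fun x => overlap a ω x ^ 2) ∂(signalNoise μ J)
      = ∑ j, ∑ k, ∫ ω, a ω.1 j * (a ω.1 k * pathGibbs μ a b s ω (fun x => a x j * a x k))
        ∂(signalNoise μ J) := by
    have e3 : ∀ ω, pathGibbs μ a b s ω (fun x => overlap a ω x ^ 2)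
        = ∑ j, ∑ k, a ω.1 j * (a ω.1 k * pathGibbs μ a b s ω (fun x => a x j * a x k)) := by
      intro ω
      simp only [← pathGibbs_const_mul]
      rw [Finset.sum_congr rfl fun j _ => (h.pathGibbs_sum s ω fun k =>
          (((h.eval_left j).mul (h.eval_left k)).const_mul _).const_mul _).symm,
        ← h.pathGibbs_sum s ω fun j => IsBoundedMeasurable.sum _ fun k =>
          (((h.eval_left j).mul (h.eval_left k)).const_mul _).const_mul _]
      congr 1
      ext x
      rw [overlap, sq, Finset.sum_mul_sum]
      exact Finset.sum_congr rfl fun j _ => Finset.sum_congr rfl fun k _ => by ring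
    simp only [e3]
    rw [integral_finsetSum _ fun j _ => (IsBoundedMeasurable.sum _ fun k =>
      (h.signal_left j).mul ((h.signal_left k).mul (bb j k))).integrable]
    exact Finset.sum_congr rfl fun j _ => integral_finsetSum _ fun k _ =>
      ((h.signal_left j).mul ((h.signal_left k).mul (bb j k))).integrable
  have e4 : ∫ ω, pathGibbs μ a b s ω (overlap a ω) ^ 2 ∂(signalNoise μ J)
      = ∑ j, ∑ k, ∫ ω, a ω.1 j * (pathGibbs μ a b s ω (fun x => a x j * a x k)
          * pathGibbs μ a b s ω (fun x => a x k)) ∂(signalNoise μ J) := by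
    have e5 : ∀ ω, pathGibbs μ a b s ω (overlap a ω) ^ 2
        = ∑ j, ∑ k, (a ω.1 j * a ω.1 k) * (pathGibbs μ a b s ω (fun x => a x j)
          * pathGibbs μ a b s ω (fun x => a x k)) := by
      intro ω
      rw [h.pathGibbs_overlap, sq, Finset.sum_mul_sum]
      exact Finset.sum_congr rfl fun j _ => Finset.sum_congr rfl fun k _ => by ring
    have bs : ∀ j k, IsBoundedMeasurable fun ω : X × (J → ℝ) => (a ω.1 j * a ω.1 k) *
        (pathGibbs μ a b s ω (fun x => a x j) * pathGibbs μ a b s ω (fun x => a x k)) :=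
      fun j k => ((h.signal_left j).mul (h.signal_left k)).mul ((b1 j).mul (b1 k))
    simp only [e5]
    rw [integral_finsetSum _ fun j _ => (IsBoundedMeasurable.sum _ fun k => bs j k).integrable]
    refine Finset.sum_congr rfl fun j _ => ?_
    rw [integral_finsetSum _ fun k _ => (bs j k).integrable]
    refine Finset.sum_congr rfl fun k _ => ?_
    have n1 := h.nishimori_path (μ := μ) s ((h.eval_left j).mul (h.eval_left k))
      ((h.gibbs_bounded (μ := μ) s (h.eval_left j)).mul (h.gibbs_bounded (μ := μ) s (h.eval_left k)))
    have n2 := h.nishimori_path (μ := μ) s (h.eval_left j)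
      ((h.gibbs_bounded (μ := μ) s ((h.eval_left j).mul (h.eval_left k))).mul
        (h.gibbs_bounded (μ := μ) s (h.eval_left k)))
    refine n1.trans (Eq.trans ?_ n2.symm)
    exact integral_congr_ae (Filter.Eventually.of_forall fun ω => by simp only [pathGibbs]; ring)
  simp only [e]
  refine ⟨integrable_finsetSum _ fun j _ => (key j).1, ?_⟩
  rw [integral_finsetSum _ fun j _ => (key j).1, e2, e4, Finset.mul_sum, ← Finset.sum_sub_distrib]
  refine Finset.sum_congr rfl fun j _ => ?_
  rw [(key j).2, Finset.sum_sub_distrib, ← Finset.mul_sum]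

end IsFeatureSplit

end DisorderAverages

/-! ### Derivatives of the averaged log-partition function and concentration of the overlap -/

section MeanDerivatives

variable {X : Type*} [MeasurableSpace X] {J : Type*} [Fintype J] {μ : Measure X}
  [IsProbabilityMeasure μ]

namespace IsFeatureSplit

variable {a b : X → J → ℝ} {M : ℝ} (h : IsFeatureSplit a b M)
include h

theorem exists_abs_pathLog_le (S : ℝ) :
    ∃ c, ∀ s ≤ S, ∀ ω, |pathLog μ a b s ω| ≤ c * noiseSize ω ^ 2 := by
  have h0 : 0 ≤ (√S + 1) * M := mul_nonneg (by positivity) h.nonneg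
  exact ⟨_, fun s hs ω => (abs_log_integral_exp_le (h.measurable_pathEnergy s ω)
    (h.abs_pathEnergy_le hs ω)).trans (mul_noiseSize_le (by positivity) ω)⟩

theorem exists_abs_score_le {r : ℝ} (hr : 0 < r) :
    ∃ c, 0 ≤ c ∧ ∀ s, r ≤ s → ∀ ω x, |score a s ω x| ≤ c * noiseSize ω := by
  have hM := h.nonneg
  exact ⟨M / (2 * √r) + Fintype.card J * (2 * M ^ 2), by positivity,
    fun s hs ω x => h.abs_score_le hr hs ω x⟩

theorem integrable_pathLog (s : ℝ) : Integrable (pathLog μ a b s) (signalNoise μ J) := by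
  obtain ⟨c, hc⟩ := h.exists_abs_pathLog_le (μ := μ) s
  exact integrable_of_abs_le_noiseSize_sq (h.measurable_pathLog s) (hc s le_rfl)

theorem continuous_integral_pathLog :
    Continuous fun s => ∫ ω, pathLog μ a b s ω ∂(signalNoise μ J) := by
  refine continuous_iff_continuousAt.2 fun s => ?_
  obtain ⟨c, hc⟩ := h.exists_abs_pathLog_le (μ := μ) (s + 1)
  exact continuousAt_of_dominated
    (Filter.Eventually.of_forall fun s => (h.measurable_pathLog s).aestronglyMeasurable)
    (Filter.eventually_of_mem (Iio_mem_nhds (lt_add_one s)) fun u hu =>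
      Filter.Eventually.of_forall (hc u (le_of_lt hu)))
    (integrable_noiseSize_sq.const_mul c)
    (Filter.Eventually.of_forall fun ω => (h.continuous_pathLog ω).continuousAt)

theorem measurable_pathGibbs_overlap (s : ℝ) :
    Measurable fun ω => pathGibbs μ a b s ω (overlap a ω) :=
  h.measurable_pathGibbs s h.measurable_uncurry_overlap

theorem continuous_integral_overlap :
    Continuous fun s => ∫ ω, pathGibbs μ a b s ω (overlap a ω) ∂(signalNoise μ J) :=
  continuous_of_dominated (bound := fun _ => Fintype.card J * M ^ 2)
    (fun s => (h.measurable_pathGibbs_overlap s).aestronglyMeasurable)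
    (fun s => Filter.Eventually.of_forall fun ω => h.abs_pathGibbs_le s ω (h.abs_overlap_le ω))
    (integrable_const _)
    (Filter.Eventually.of_forall fun ω =>
      h.continuous_pathGibbs ω (h.overlap_bounded ω).measurable (h.abs_overlap_le ω))

theorem integral_overlap_nonneg (s : ℝ) :
    0 ≤ ∫ ω, pathGibbs μ a b s ω (overlap a ω) ∂(signalNoise μ J) := by
  rw [h.integral_overlap]
  exact Finset.sum_nonneg fun j _ => integral_nonneg fun ω => sq_nonneg _

theorem measurable_pathGibbs_score (s : ℝ) :
    Measurable fun ω => pathGibbs μ a b s ω (score a s ω) :=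
  h.measurable_pathGibbs s (h.measurable_uncurry_score s)

theorem measurable_pathGibbs_score_sq (s : ℝ) :
    Measurable fun ω => pathGibbs μ a b s ω (fun x => score a s ω x ^ 2) :=
  h.measurable_pathGibbs s ((h.measurable_uncurry_score s).pow_const 2)

theorem measurable_pathGibbs_scoreDeriv (s : ℝ) :
    Measurable fun ω => pathGibbs μ a b s ω (scoreDeriv a s ω) :=
  h.measurable_pathGibbs s (h.measurable_uncurry_scoreDeriv s)

theorem hasDerivAt_integral_pathLog {s : ℝ} (hs : 0 < s) :
    HasDerivAt (fun s => ∫ ω, pathLog μ a b s ω ∂(signalNoise μ J))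
      (1 / 2 * ∫ ω, pathGibbs μ a b s ω (overlap a ω) ∂(signalNoise μ J)) s := by
  obtain ⟨c, hc0, hc⟩ := h.exists_abs_score_le (half_pos hs)
  rw [← (h.integral_score hs).2]
  exact (hasDerivAt_integral_of_dominated_loc_of_deriv_le (s := Set.Ioi (s / 2))
    (F := fun s ω => pathLog μ a b s ω) (F' := fun s ω => pathGibbs μ a b s ω (score a s ω))
    (Ioi_mem_nhds (half_lt_self hs))
    (Filter.Eventually.of_forall fun s => (h.measurable_pathLog s).aestronglyMeasurable)
    (h.integrable_pathLog s) (h.measurable_pathGibbs_score s).aestronglyMeasurable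
    (Filter.Eventually.of_forall fun ω u hu =>
      (h.abs_pathGibbs_le u ω (hc u (le_of_lt hu) ω)).trans (mul_noiseSize_le hc0 ω))
    (integrable_noiseSize_sq.const_mul c)
    (Filter.Eventually.of_forall fun ω u hu =>
      h.hasDerivAt_pathLog ((half_pos hs).trans hu) ω)).2

/-- At `s = 0` the function is not differentiable for fixed disorder, because of the term `√s g · a`;
the derivative of the average is obtained as the limit of the derivatives at `s > 0`. -/
theorem hasDerivWithinAt_integral_pathLog {s : ℝ} (hs : 0 ≤ s) :
    HasDerivWithinAt (fun s => ∫ ω, pathLog μ a b s ω ∂(signalNoise μ J))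
      (1 / 2 * ∫ ω, pathGibbs μ a b s ω (overlap a ω) ∂(signalNoise μ J)) (Set.Ici 0) s := by
  rcases hs.eq_or_lt with rfl | hs
  · refine hasDerivWithinAt_Ici_of_tendsto_deriv (s := Set.Ioi 0)
      (fun u hu => (h.hasDerivAt_integral_pathLog hu).differentiableAt.differentiableWithinAt)
      h.continuous_integral_pathLog.continuousWithinAt self_mem_nhdsWithin ?_
    have hc := ((h.continuous_integral_overlap (μ := μ)).const_mul (1 / 2)).tendsto 0
    exact (hc.mono_left nhdsWithin_le_nhds).congr' (Filter.eventually_of_mem self_mem_nhdsWithin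
      fun u hu => (h.hasDerivAt_integral_pathLog hu).deriv.symm)
  · exact (h.hasDerivAt_integral_pathLog hs).hasDerivWithinAt

/-- The second derivative of the averaged log-partition function in the form
`𝔼[⟨L'⟩ + ⟨L²⟩ - ⟨L⟩²]`, which contains the thermal fluctuations of the score `L`. -/
theorem hasDerivAt_integral_score {s : ℝ} (hs : 0 < s) :
    HasDerivAt (fun s => ∫ ω, pathGibbs μ a b s ω (score a s ω) ∂(signalNoise μ J))
      (∫ ω, (pathGibbs μ a b s ω (scoreDeriv a s ω)
        + pathGibbs μ a b s ω (fun x => score a s ω x ^ 2)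
        - pathGibbs μ a b s ω (score a s ω) ^ 2) ∂(signalNoise μ J)) s := by
  obtain ⟨c, hc0, hc⟩ := h.exists_abs_score_le (half_pos hs)
  have hM := h.nonneg
  set d := M / (4 * (s / 2) * √(s / 2)) with hd
  have hd0 : 0 ≤ d := by positivity
  refine (hasDerivAt_integral_of_dominated_loc_of_deriv_le (s := Set.Ioi (s / 2))
    (F := fun s ω => pathGibbs μ a b s ω (score a s ω))
    (F' := fun s ω => pathGibbs μ a b s ω (scoreDeriv a s ω)
        + pathGibbs μ a b s ω (fun x => score a s ω x ^ 2)
        - pathGibbs μ a b s ω (score a s ω) ^ 2)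
    (bound := fun ω => (d + c ^ 2 + c ^ 2) * noiseSize ω ^ 2)
    (Ioi_mem_nhds (half_lt_self hs))
    (Filter.Eventually.of_forall fun s => (h.measurable_pathGibbs_score s).aestronglyMeasurable)
    (h.integral_score hs).1
    (((h.measurable_pathGibbs_scoreDeriv s).add (h.measurable_pathGibbs_score_sq s)).sub
      ((h.measurable_pathGibbs_score s).pow_const 2)).aestronglyMeasurable
    (Filter.Eventually.of_forall fun ω u hu => ?_)
    (integrable_noiseSize_sq.const_mul _)
    (Filter.Eventually.of_forall fun ω u hu =>
      h.hasDerivAt_pathGibbs_score ((half_pos hs).trans hu) ω)).2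
  have h1 := (h.abs_pathGibbs_le (μ := μ) u ω
    (h.abs_scoreDeriv_le (half_pos hs) (le_of_lt hu) ω)).trans (mul_noiseSize_le hd0 ω)
  have h2 : |pathGibbs μ a b u ω (fun x => score a u ω x ^ 2)| ≤ (c * noiseSize ω) ^ 2 :=
    h.abs_pathGibbs_le u ω fun x => by
      rw [abs_pow]
      exact pow_le_pow_left₀ (abs_nonneg _) (hc u (le_of_lt hu) ω x) 2
  have h3 : |pathGibbs μ a b u ω (score a u ω) ^ 2| ≤ (c * noiseSize ω) ^ 2 := by
    rw [abs_pow]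
    exact pow_le_pow_left₀ (abs_nonneg _) (h.abs_pathGibbs_le u ω (hc u (le_of_lt hu) ω)) 2
  rw [mul_pow] at h2 h3
  rw [Real.norm_eq_abs, add_mul, add_mul]
  exact (abs_sub _ _).trans (add_le_add ((abs_add_le _ _).trans (add_le_add h1 h2)) h3)

theorem hasDerivAt_integral_pathGibbs_sq {s : ℝ} (hs : 0 < s) {f : X → ℝ}
    (hf : IsBoundedMeasurable f) :
    HasDerivAt (fun s => ∫ ω, pathGibbs μ a b s ω f ^ 2 ∂(signalNoise μ J))
      (∫ ω, 2 * (pathGibbs μ a b s ω f * (pathGibbs μ a b s ω (fun x => f x * score a s ω x)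
        - pathGibbs μ a b s ω f * pathGibbs μ a b s ω (score a s ω))) ∂(signalNoise μ J)) s := by
  obtain ⟨c, hc0, hc⟩ := h.exists_abs_score_le (half_pos hs)
  obtain ⟨B, hB⟩ := hf.exists_abs_le
  have hB0 : ∀ x : X, 0 ≤ B := fun x => (abs_nonneg _).trans (hB x)
  have hm : Measurable (Function.uncurry fun (ω : X × (J → ℝ)) x => f x * score a s ω x) :=
    (hf.measurable.comp measurable_snd).mul (h.measurable_uncurry_score s)
  refine (hasDerivAt_integral_of_dominated_loc_of_deriv_le (s := Set.Ioi (s / 2))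
    (F := fun s ω => pathGibbs μ a b s ω f ^ 2)
    (F' := fun s ω => 2 * (pathGibbs μ a b s ω f *
      (pathGibbs μ a b s ω (fun x => f x * score a s ω x)
        - pathGibbs μ a b s ω f * pathGibbs μ a b s ω (score a s ω))))
    (bound := fun ω => (2 * (B * (B * c + B * c))) * noiseSize ω ^ 2)
    (Ioi_mem_nhds (half_lt_self hs))
    (Filter.Eventually.of_forall fun s =>
      ((h.pathGibbs_bounded s hf).pow 2).measurable.aestronglyMeasurable)
    ((h.pathGibbs_bounded s hf).pow 2).integrable
    (((h.measurable_pathGibbs_const s hf.measurable).mul ((h.measurable_pathGibbs s hm).sub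
      ((h.measurable_pathGibbs_const s hf.measurable).mul
        (h.measurable_pathGibbs_score s)))).const_mul 2).aestronglyMeasurable
    (Filter.Eventually.of_forall fun ω u hu => ?_)
    (integrable_noiseSize_sq.const_mul _)
    (Filter.Eventually.of_forall fun ω u hu => ?_)).2
  · have hB1 := hB0 ω.1
    have h1 := h.abs_pathGibbs_le (μ := μ) u ω hB
    have h2 := h.abs_pathGibbs_le (μ := μ) u ω (hc u (le_of_lt hu) ω)
    have h3 : |pathGibbs μ a b u ω (fun x => f x * score a u ω x)| ≤ B * (c * noiseSize ω) :=
      h.abs_pathGibbs_le u ω fun x => by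
        rw [abs_mul]
        exact mul_le_mul (hB x) (hc u (le_of_lt hu) ω x) (abs_nonneg _) hB1
    refine le_trans ?_ (mul_noiseSize_le (by positivity) ω)
    rw [Real.norm_eq_abs, abs_mul, abs_two, abs_mul]
    have h4 := (abs_sub (pathGibbs μ a b u ω (fun x => f x * score a u ω x))
      (pathGibbs μ a b u ω f * pathGibbs μ a b u ω (score a u ω))).trans (add_le_add h3
        ((abs_mul _ _).trans_le (mul_le_mul h1 h2 (abs_nonneg _) hB1)))
    have h5 := mul_le_mul h1 h4 (abs_nonneg _) hB1
    calc _ ≤ 2 * (B * (B * (c * noiseSize ω) + B * (c * noiseSize ω))) := by gcongr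
      _ = _ := by ring
  · exact ((h.hasDerivAt_pathGibbs ((half_pos hs).trans hu) ω hf.measurable hB).pow 2).congr_deriv
      (by simp; ring)

/-- The derivative of `𝔼[⟨f⟩²]` equals `∑ₖ 𝔼[(⟨f aₖ⟩ - ⟨f⟩ ⟨aₖ⟩)²]`: after integration by parts the
remaining terms cancel by the Nishimori identity. -/
theorem integral_pathGibbs_mul_covariance_score {s : ℝ} (hs : 0 < s) {f : X → ℝ}
    (hf : IsBoundedMeasurable f) :
    ∫ ω, 2 * (pathGibbs μ a b s ω f * (pathGibbs μ a b s ω (fun x => f x * score a s ω x)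
        - pathGibbs μ a b s ω f * pathGibbs μ a b s ω (score a s ω))) ∂(signalNoise μ J)
      = ∑ k, ∫ ω, (pathGibbs μ a b s ω (fun x => f x * a x k)
        - pathGibbs μ a b s ω f * pathGibbs μ a b s ω (fun x => a x k)) ^ 2
          ∂(signalNoise μ J) := by
  have hq : 0 < √s := Real.sqrt_pos.2 hs
  have g0 := h.pathGibbs_bounded (μ := μ) s hf
  have g1 := fun k => h.pathGibbs_bounded (μ := μ) s (hf.mul (h.eval_left k))
  have g2 := fun k => h.pathGibbs_bounded (μ := μ) s (hf.mul ((h.eval_left k).pow 2))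
  have g3 := fun k => h.pathGibbs_bounded (μ := μ) s (h.eval_left k)
  have g4 := fun k => h.pathGibbs_bounded (μ := μ) s ((h.eval_left k).pow 2)
  have gc := fun k => (g1 k).sub (g0.mul (g3 k))
  have gd := fun k => (g2 k).sub (g0.mul (g4 k))
  have e : ∀ ω, 2 * (pathGibbs μ a b s ω f * (pathGibbs μ a b s ω (fun x => f x * score a s ω x)
        - pathGibbs μ a b s ω f * pathGibbs μ a b s ω (score a s ω)))
      = ∑ k, ((1 / √s) * (ω.2 k * (pathGibbs μ a b s ω f * (pathGibbs μ a b s ω (fun x => f x * a x k)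
          - pathGibbs μ a b s ω f * pathGibbs μ a b s ω (fun x => a x k))))
        + (2 * (a ω.1 k * (pathGibbs μ a b s ω f * (pathGibbs μ a b s ω (fun x => f x * a x k)
          - pathGibbs μ a b s ω f * pathGibbs μ a b s ω (fun x => a x k))))
        - pathGibbs μ a b s ω f * (pathGibbs μ a b s ω (fun x => f x * a x k ^ 2)
          - pathGibbs μ a b s ω f * pathGibbs μ a b s ω (fun x => a x k ^ 2)))) := by
    intro ω
    rw [h.pathGibbs_mul_score s ω hf, h.pathGibbs_score, Finset.mul_sum, ← Finset.sum_sub_distrib,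
      Finset.mul_sum, Finset.mul_sum]
    refine Finset.sum_congr rfl fun k _ => ?_
    field_simp
    ring
  have i1 := fun k => ((g0.mul (gc k)).noise_mul (μ := μ) k).const_mul (1 / √s)
  have i2 := fun k => (((h.signal_left k).mul (g0.mul (gc k))).integrable
    (μ := signalNoise μ J)).const_mul 2
  have i3 := fun k => (g0.mul (gd k)).integrable (μ := signalNoise μ J)
  simp only [e]
  refine (integral_finsetSum _ fun k _ => (i1 k).add ((i2 k).sub (i3 k))).trans
    (Finset.sum_congr rfl fun k _ => ?_)
  refine ((integral_add (i1 k) ((i2 k).sub (i3 k))).trans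
    (congrArg _ (integral_sub (i2 k) (i3 k)))).trans ?_
  have b0 := h.gibbs_bounded (μ := μ) s hf
  have b1 := h.gibbs_bounded (μ := μ) s (hf.mul (h.eval_left k))
  have b3 := h.gibbs_bounded (μ := μ) s (h.eval_left k)
  have n := h.nishimori_path (μ := μ) s (h.eval_left k) (b0.mul (b1.sub (b0.mul b3)))
  have n' : ∫ ω, a ω.1 k * (pathGibbs μ a b s ω f * (pathGibbs μ a b s ω (fun x => f x * a x k)
          - pathGibbs μ a b s ω f * pathGibbs μ a b s ω (fun x => a x k))) ∂(signalNoise μ J)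
      = ∫ ω, pathGibbs μ a b s ω (fun x => a x k) * (pathGibbs μ a b s ω f *
          (pathGibbs μ a b s ω (fun x => f x * a x k)
          - pathGibbs μ a b s ω f * pathGibbs μ a b s ω (fun x => a x k))) ∂(signalNoise μ J) := n
  rw [integral_const_mul, integral_const_mul, h.integral_noise_mul_gibbs_covariance s k hf, n']
  have c1 := ((gc k).pow 2).integrable (μ := signalNoise μ J)
  have c2 := ((g3 k).mul (g0.mul (gc k))).integrable (μ := signalNoise μ J)
  have split : ∫ ω, ((pathGibbs μ a b s ω (fun x => f x * a x k)
            - pathGibbs μ a b s ω f * pathGibbs μ a b s ω (fun x => a x k)) ^ 2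
          + pathGibbs μ a b s ω f * (pathGibbs μ a b s ω (fun x => f x * a x k ^ 2)
            - pathGibbs μ a b s ω f * pathGibbs μ a b s ω (fun x => a x k ^ 2)
            - 2 * pathGibbs μ a b s ω (fun x => a x k)
              * (pathGibbs μ a b s ω (fun x => f x * a x k)
            - pathGibbs μ a b s ω f * pathGibbs μ a b s ω (fun x => a x k)))) ∂(signalNoise μ J)
      = ∫ ω, (pathGibbs μ a b s ω (fun x => f x * a x k)
        - pathGibbs μ a b s ω f * pathGibbs μ a b s ω (fun x => a x k)) ^ 2 ∂(signalNoise μ J)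
      + (∫ ω, pathGibbs μ a b s ω f * (pathGibbs μ a b s ω (fun x => f x * a x k ^ 2)
          - pathGibbs μ a b s ω f * pathGibbs μ a b s ω (fun x => a x k ^ 2)) ∂(signalNoise μ J)
      - 2 * ∫ ω, pathGibbs μ a b s ω (fun x => a x k) * (pathGibbs μ a b s ω f *
          (pathGibbs μ a b s ω (fun x => f x * a x k)
          - pathGibbs μ a b s ω f * pathGibbs μ a b s ω (fun x => a x k))) ∂(signalNoise μ J)) := by
    rw [← integral_const_mul, ← integral_sub (i3 k) (c2.const_mul 2)]
    refine Eq.trans ?_ (integral_add c1 ((i3 k).sub (c2.const_mul 2)))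
    exact integral_congr_ae (Filter.Eventually.of_forall fun ω => by
      simp only; ring)
  rw [split]
  field_simp
  ring

/-- Convexity of the averaged log-partition function for `s > 0`: its derivative is `𝔼|⟨a⟩|² / 2`,
which is nondecreasing in `s`. -/
theorem exists_hasDerivAt_integral_overlap_nonneg {s : ℝ} (hs : 0 < s) :
    ∃ D, 0 ≤ D ∧ HasDerivAt
      (fun s => 1 / 2 * ∫ ω, pathGibbs μ a b s ω (overlap a ω) ∂(signalNoise μ J)) D s := by
  simp only [h.integral_overlap]
  refine ⟨_, ?_, (HasDerivAt.fun_sum fun j _ =>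
    h.hasDerivAt_integral_pathGibbs_sq hs (h.eval_left j)).const_mul _⟩
  simp only [h.integral_pathGibbs_mul_covariance_score hs (h.eval_left _)]
  exact mul_nonneg (by norm_num) (Finset.sum_nonneg fun j _ => Finset.sum_nonneg fun k _ =>
    integral_nonneg fun ω => sq_nonneg _)

/-- By integration by parts, `𝔼⟨L'⟩ = -𝔼[⟨|a|²⟩ - |⟨a⟩|²] / (4s)`. -/
theorem integral_scoreDeriv_ge {s : ℝ} (hs : 0 < s) {S : ℝ} (hS : ∀ x, ∑ j, a x j ^ 2 ≤ S) :
    Integrable (fun ω => pathGibbs μ a b s ω (scoreDeriv a s ω)) (signalNoise μ J) ∧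
    -(S / (4 * s)) ≤ ∫ ω, pathGibbs μ a b s ω (scoreDeriv a s ω) ∂(signalNoise μ J) := by
  have hq : 0 < √s := Real.sqrt_pos.2 hs
  have g1 := fun k => h.pathGibbs_bounded (μ := μ) s (h.eval_left k)
  have g2 := fun k => h.pathGibbs_bounded (μ := μ) s ((h.eval_left k).pow 2)
  have i1 := fun k => ((g1 k).noise_mul (μ := μ) k).const_mul (-(1 / (4 * s * √s)))
  have e : ∀ ω, pathGibbs μ a b s ω (scoreDeriv a s ω)
      = ∑ k, -(1 / (4 * s * √s)) * (ω.2 k * pathGibbs μ a b s ω (fun x => a x k)) := fun ω => by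
    rw [h.pathGibbs_scoreDeriv]
    exact Finset.sum_congr rfl fun k _ => by ring
  simp only [e]
  refine ⟨integrable_finsetSum _ fun k _ => i1 k, ?_⟩
  rw [integral_finsetSum _ fun k _ => i1 k]
  have e2 : ∀ k, ∫ ω, -(1 / (4 * s * √s)) * (ω.2 k * pathGibbs μ a b s ω (fun x => a x k))
        ∂(signalNoise μ J)
      = -(1 / (4 * s)) * ∫ ω, (pathGibbs μ a b s ω (fun x => a x k ^ 2)
        - pathGibbs μ a b s ω (fun x => a x k) * pathGibbs μ a b s ω (fun x => a x k))
          ∂(signalNoise μ J) := fun k => by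
    have := h.integral_noise_mul_gibbs (μ := μ) s k (IsBoundedMeasurable.const 1)
      (IsBoundedMeasurable.const 1)
    simp only [one_mul] at this
    rw [integral_const_mul, this]
    field_simp
  simp only [e2]
  rw [← Finset.mul_sum, ← integral_finsetSum _ fun k _ =>
    ((g2 k).sub ((g1 k).mul (g1 k))).integrable]
  have hle : ∫ ω, ∑ k, (pathGibbs μ a b s ω (fun x => a x k ^ 2)
        - pathGibbs μ a b s ω (fun x => a x k) * pathGibbs μ a b s ω (fun x => a x k))
          ∂(signalNoise μ J) ≤ S := by
    have := integral_mono (μ := signalNoise μ J) (g := fun _ => S)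
      ((IsBoundedMeasurable.sum Finset.univ fun k =>
        (g2 k).sub ((g1 k).mul (g1 k))).integrable) (integrable_const S) (fun ω => by
        have hp := h.isProbabilityMeasure_path (μ := μ) s ω
        calc ∑ k, (pathGibbs μ a b s ω (fun x => a x k ^ 2)
              - pathGibbs μ a b s ω (fun x => a x k) * pathGibbs μ a b s ω (fun x => a x k))
            ≤ ∑ k, pathGibbs μ a b s ω (fun x => a x k ^ 2) :=
              Finset.sum_le_sum fun k _ => sub_le_self _ (mul_self_nonneg _)
          _ = pathGibbs μ a b s ω (fun x => ∑ k, a x k ^ 2) :=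
              (h.pathGibbs_sum s ω fun k => (h.eval_left k).pow 2).symm
          _ ≤ ∫ _, S ∂(μ.tilted (pathEnergy a b s ω)) :=
              integral_mono (IsBoundedMeasurable.sum _ fun k =>
                (h.eval_left k).pow 2).integrable (integrable_const S) hS
          _ = S := by simp)
    simpa using this
  rw [neg_mul, neg_le_neg_iff, one_div, inv_mul_eq_div]
  gcongr

/-- The pointwise form, for fixed disorder, of the inequality
`(R - m) (L - c) ≤ (R - m)² / 4 + (L - c)²`. -/
theorem pathGibbs_mul_score_le {s : ℝ} (hs : 0 < s) (ω : X × (J → ℝ)) (m c : ℝ) :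
    pathGibbs μ a b s ω (fun x => overlap a ω x * score a s ω x)
        - c * pathGibbs μ a b s ω (overlap a ω) - m * pathGibbs μ a b s ω (score a s ω) + m * c
      ≤ 1 / 4 * (pathGibbs μ a b s ω (fun x => overlap a ω x ^ 2)
          - 2 * m * pathGibbs μ a b s ω (overlap a ω) + m ^ 2)
        + (pathGibbs μ a b s ω (fun x => score a s ω x ^ 2)
          - 2 * c * pathGibbs μ a b s ω (score a s ω) + c ^ 2) := by
  have hp := h.isProbabilityMeasure_path (μ := μ) s ω
  set T := μ.tilted (pathEnergy a b s ω)
  have bL := h.score_bounded hs ω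
  have bR := h.overlap_bounded ω
  have iL := bL.integrable (μ := T)
  have iR := bR.integrable (μ := T)
  have iLL := (bL.pow 2).integrable (μ := T)
  have iRR := (bR.pow 2).integrable (μ := T)
  have iRL := (bR.mul bL).integrable (μ := T)
  have h0 : 0 ≤ ∫ x, ((1 / 2) * (overlap a ω x - m) - (score a s ω x - c)) ^ 2 ∂T :=
    integral_nonneg fun x => sq_nonneg _
  have e : (fun x => ((1 / 2) * (overlap a ω x - m) - (score a s ω x - c)) ^ 2)
      = fun x => (1 / 4) * overlap a ω x ^ 2 + (score a s ω x ^ 2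
        + (-1 * (overlap a ω x * score a s ω x) + ((c - m / 2) * overlap a ω x
          + ((m - 2 * c) * score a s ω x + (m / 2 - c) ^ 2)))) := by
    ext x; ring
  have i5 := (iL.const_mul (m - 2 * c)).add (integrable_const (μ := T) ((m / 2 - c) ^ 2))
  have i4 := (iR.const_mul (c - m / 2)).add i5
  have i3 := (iRL.const_mul (-1)).add i4
  have i2 := iLL.add i3
  rw [e] at h0
  have e1 := integral_add (iRR.const_mul (1 / 4)) i2
  have e2 := integral_add iLL i3
  have e3 := integral_add (iRL.const_mul (-1)) i4
  have e4 := integral_add (iR.const_mul (c - m / 2)) i5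
  have e5 := integral_add (iL.const_mul (m - 2 * c)) (integrable_const (μ := T) ((m / 2 - c) ^ 2))
  simp only [Pi.add_apply, integral_const_mul, integral_const, probReal_univ, one_smul] at e1 e2 e3 e4 e5
  rw [e1, e2, e3, e4, e5] at h0
  change ∫ x, overlap a ω x * score a s ω x ∂T - c * ∫ x, overlap a ω x ∂T
      - m * ∫ x, score a s ω x ∂T + m * c ≤ 1 / 4 * (∫ x, overlap a ω x ^ 2 ∂T
        - 2 * m * ∫ x, overlap a ω x ∂T + m ^ 2) + (∫ x, score a s ω x ^ 2 ∂T
        - 2 * c * ∫ x, score a s ω x ∂T + c ^ 2)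
  linarith

theorem pathGibbs_sq_le {s : ℝ} (ω : X × (J → ℝ)) {f : X → ℝ} (hf : IsBoundedMeasurable f) :
    pathGibbs μ a b s ω f ^ 2 ≤ pathGibbs μ a b s ω (fun x => f x ^ 2) := by
  have hp := h.isProbabilityMeasure_path (μ := μ) s ω
  exact hf.sq_integral_le (μ := μ.tilted (pathEnergy a b s ω))

/-- The variance of the overlap is controlled by the second derivative `D` of the averaged
log-partition function and by the fluctuations over the disorder of its first derivative `⟨L⟩`. -/
theorem overlap_concentration {s : ℝ} (hs : 0 < s) {S : ℝ} (hS : ∀ x, ∑ j, a x j ^ 2 ≤ S) :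
    ∃ D, 0 ≤ D ∧ HasDerivAt
        (fun s => 1 / 2 * ∫ ω, pathGibbs μ a b s ω (overlap a ω) ∂(signalNoise μ J)) D s ∧
      ∀ m, m = ∫ ω, pathGibbs μ a b s ω (overlap a ω) ∂(signalNoise μ J) →
        Integrable (fun ω => (pathGibbs μ a b s ω (score a s ω) - 1 / 2 * m) ^ 2)
          (signalNoise μ J) ∧
        ∫ ω, pathGibbs μ a b s ω (fun x => overlap a ω x ^ 2) ∂(signalNoise μ J) - m ^ 2
          ≤ 4 * (D + S / (4 * s)
            + ∫ ω, (pathGibbs μ a b s ω (score a s ω) - 1 / 2 * m) ^ 2 ∂(signalNoise μ J)) := by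
  obtain ⟨D, hD0, hD⟩ := h.exists_hasDerivAt_integral_overlap_nonneg (μ := μ) hs
  refine ⟨D, hD0, hD, fun m hm => ?_⟩
  obtain ⟨c, hc0, hc⟩ := h.exists_abs_score_le hs
  have hc' := fun ω => hc s le_rfl ω
  -- The two expressions of the second derivative agree, since they differentiate the same function.
  have hD2 : D = ∫ ω, (pathGibbs μ a b s ω (scoreDeriv a s ω)
        + pathGibbs μ a b s ω (fun x => score a s ω x ^ 2)
        - pathGibbs μ a b s ω (score a s ω) ^ 2) ∂(signalNoise μ J) := by
    refine hD.unique ((h.hasDerivAt_integral_score hs).congr_of_eventuallyEq ?_)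
    exact Filter.eventually_of_mem (Ioi_mem_nhds hs) fun u hu => (h.integral_score hu).2.symm
  obtain ⟨iD, hDge⟩ := h.integral_scoreDeriv_ge (μ := μ) hs hS
  obtain ⟨iL, hL⟩ := h.integral_score (μ := μ) hs
  obtain ⟨iRL, hRL⟩ := h.integral_overlap_mul_score (μ := μ) hs
  have iR : Integrable (fun ω => pathGibbs μ a b s ω (overlap a ω)) (signalNoise μ J) :=
    integrable_of_abs_le (h.measurable_pathGibbs_overlap s)
      fun ω => h.abs_pathGibbs_le s ω (h.abs_overlap_le ω)
  have iR2 : Integrable (fun ω => pathGibbs μ a b s ω (overlap a ω) ^ 2) (signalNoise μ J) :=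
    (IsBoundedMeasurable.pow ⟨h.measurable_pathGibbs_overlap s, _,
      fun ω => h.abs_pathGibbs_le s ω (h.abs_overlap_le ω)⟩ 2).integrable
  have iRR : Integrable (fun ω => pathGibbs μ a b s ω (fun x => overlap a ω x ^ 2))
      (signalNoise μ J) :=
    integrable_of_abs_le (B := (Fintype.card J * M ^ 2) ^ 2)
      (h.measurable_pathGibbs s (h.measurable_uncurry_overlap.pow_const 2))
      fun ω => h.abs_pathGibbs_le s ω fun x => by
        rw [abs_pow]; exact pow_le_pow_left₀ (abs_nonneg _) (h.abs_overlap_le ω x) 2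
  have iL2 : Integrable (fun ω => pathGibbs μ a b s ω (score a s ω) ^ 2) (signalNoise μ J) :=
    integrable_of_abs_le_noiseSize_sq (c := c ^ 2) ((h.measurable_pathGibbs_score s).pow_const 2)
      fun ω => by
        rw [abs_pow, ← mul_pow]
        exact pow_le_pow_left₀ (abs_nonneg _) (h.abs_pathGibbs_le s ω (hc' ω)) 2
  have iLL : Integrable (fun ω => pathGibbs μ a b s ω (fun x => score a s ω x ^ 2))
      (signalNoise μ J) :=
    integrable_of_abs_le_noiseSize_sq (c := c ^ 2) (h.measurable_pathGibbs_score_sq s) fun ω =>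
      h.abs_pathGibbs_le s ω fun x => by
        rw [abs_pow, ← mul_pow]; exact pow_le_pow_left₀ (abs_nonneg _) (hc' ω x) 2
  have eV : ∫ ω, (pathGibbs μ a b s ω (score a s ω) - 1 / 2 * m) ^ 2 ∂(signalNoise μ J)
      = ∫ ω, pathGibbs μ a b s ω (score a s ω) ^ 2 ∂(signalNoise μ J) - (1 / 2 * m) ^ 2 := by
    have i3 := (iL.const_mul (-m)).add
      (integrable_const (μ := signalNoise μ J) ((1 / 2 * m) ^ 2))
    have e1 := integral_add iL2 i3
    have e2 := integral_add (iL.const_mul (-m))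
      (integrable_const (μ := signalNoise μ J) ((1 / 2 * m) ^ 2))
    simp only [Pi.add_apply, integral_const_mul, integral_const, probReal_univ, one_smul] at e1 e2
    have e : (fun ω => (pathGibbs μ a b s ω (score a s ω) - 1 / 2 * m) ^ 2)
        = fun ω => pathGibbs μ a b s ω (score a s ω) ^ 2 + (-m * pathGibbs μ a b s ω (score a s ω)
          + (1 / 2 * m) ^ 2) := by ext ω; ring
    rw [e, e1, e2, hL, ← hm]
    ring
  refine ⟨?_, ?_⟩
  · have := (iL2.sub (iL.const_mul m)).add
      (integrable_const (μ := signalNoise μ J) ((1 / 2 * m) ^ 2))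
    refine this.congr (Filter.Eventually.of_forall fun ω => ?_)
    simp only [Pi.add_apply, Pi.sub_apply]
    ring
  have eD : D = ∫ ω, pathGibbs μ a b s ω (scoreDeriv a s ω) ∂(signalNoise μ J)
        + ∫ ω, pathGibbs μ a b s ω (fun x => score a s ω x ^ 2) ∂(signalNoise μ J)
        - ∫ ω, pathGibbs μ a b s ω (score a s ω) ^ 2 ∂(signalNoise μ J) := by
    rw [hD2, ← integral_add iD iLL]
    exact integral_sub (iD.add iLL) iL2
  have hJ : ∫ ω, pathGibbs μ a b s ω (overlap a ω) ^ 2 ∂(signalNoise μ J)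
      ≤ ∫ ω, pathGibbs μ a b s ω (fun x => overlap a ω x ^ 2) ∂(signalNoise μ J) :=
    integral_mono iR2 iRR fun ω => h.pathGibbs_sq_le ω (h.overlap_bounded ω)
  -- Averaged over the disorder, the left side becomes the covariance of the overlap and the score,
  -- which is at least half the variance of the overlap; a quarter of it is absorbed from the right.
  have hmono := integral_mono (μ := signalNoise μ J)
    (((iRL.sub (iR.const_mul (1 / 2 * m))).sub (iL.const_mul m)).add
      (integrable_const (m * (1 / 2 * m))))
    ((((iRR.sub (iR.const_mul (2 * m))).add (integrable_const (m ^ 2))).const_mul (1 / 4)).add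
      ((iLL.sub (iL.const_mul (2 * (1 / 2 * m)))).add (integrable_const ((1 / 2 * m) ^ 2))))
    (fun ω => h.pathGibbs_mul_score_le hs ω m (1 / 2 * m))
  have ea := integral_add ((iRL.sub (iR.const_mul (1 / 2 * m))).sub (iL.const_mul m))
      (integrable_const (m * (1 / 2 * m)))
  have eb := integral_sub (iRL.sub (iR.const_mul (1 / 2 * m))) (iL.const_mul m)
  have ec := integral_sub iRL (iR.const_mul (1 / 2 * m))
  have ed := integral_add
    (((iRR.sub (iR.const_mul (2 * m))).add (integrable_const (m ^ 2))).const_mul (1 / 4))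
    ((iLL.sub (iL.const_mul (2 * (1 / 2 * m)))).add (integrable_const ((1 / 2 * m) ^ 2)))
  have ee := integral_add (iRR.sub (iR.const_mul (2 * m))) (integrable_const (m ^ 2))
  have ef := integral_sub iRR (iR.const_mul (2 * m))
  have eg := integral_add (iLL.sub (iL.const_mul (2 * (1 / 2 * m))))
    (integrable_const ((1 / 2 * m) ^ 2))
  have eh := integral_sub iLL (iL.const_mul (2 * (1 / 2 * m)))
  simp only [Pi.add_apply, Pi.sub_apply, integral_const_mul, integral_const, probReal_univ,
    one_smul] at hmono ea eb ec ed ee ef eg eh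
  rw [ea, eb, ec, ed, ee, ef, eg, eh, hRL, hL, ← hm] at hmono
  rw [eV]
  linarith

end IsFeatureSplit

end MeanDerivatives

section PowerOfOverlap

variable {X : Type*} [MeasurableSpace X] {J : Type*} [Fintype J] {μ : Measure X}
  [IsProbabilityMeasure μ] {a b : X → J → ℝ} {M : ℝ}

/-- The mean of a power of a bounded overlap differs from the power of its mean by at most a multiple
of the standard deviation of the overlap. -/
theorem IsFeatureSplit.sq_integral_overlap_pow_sub_le (h : IsFeatureSplit a b M) (s : ℝ) (p : ℕ)
    {κ B : ℝ} (hB : ∀ ω x, |κ * overlap (J := J) a ω x| ≤ B) {m : ℝ}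
    (hm : m = ∫ ω, pathGibbs μ a b s ω (overlap a ω) ∂(signalNoise μ J)) :
    (∫ ω, pathGibbs μ a b s ω (fun x => (κ * overlap a ω x) ^ p) ∂(signalNoise μ J)
        - (κ * m) ^ p) ^ 2
      ≤ (p * B ^ (p - 1)) ^ 2 * (κ ^ 2 *
        (∫ ω, pathGibbs μ a b s ω (fun x => overlap a ω x ^ 2) ∂(signalNoise μ J) - m ^ 2)) := by
  have hu := h.measurable_uncurry_overlap
  have bR := fun ω => h.overlap_bounded ω
  have gR : IsBoundedMeasurable fun ω => pathGibbs μ a b s ω (overlap a ω) :=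
    ⟨h.measurable_pathGibbs_overlap s, _, fun ω => h.abs_pathGibbs_le s ω (h.abs_overlap_le ω)⟩
  have gRR : IsBoundedMeasurable fun ω => pathGibbs μ a b s ω (fun x => overlap a ω x ^ 2) :=
    ⟨h.measurable_pathGibbs s (hu.pow_const 2), (Fintype.card J * M ^ 2) ^ 2,
      fun ω => h.abs_pathGibbs_le s ω fun x => by
        rw [abs_pow]; exact pow_le_pow_left₀ (abs_nonneg _) (h.abs_overlap_le ω x) 2⟩
  have gRp : IsBoundedMeasurable fun ω => pathGibbs μ a b s ω (fun x => (κ * overlap a ω x) ^ p) :=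
    ⟨h.measurable_pathGibbs s ((hu.const_mul κ).pow_const p), B ^ p,
      fun ω => h.abs_pathGibbs_le s ω fun x => by
        rw [abs_pow]; exact pow_le_pow_left₀ (abs_nonneg _) (hB ω x) p⟩
  have hmB : |κ * m| ≤ B := by
    rw [hm, ← integral_const_mul]
    refine abs_integral_le_of_abs_le fun ω => ?_
    rw [← IsFeatureSplit.pathGibbs_const_mul]
    exact h.abs_pathGibbs_le s ω (hB ω)
  have e1 : ∫ ω, pathGibbs μ a b s ω (fun x => (κ * overlap a ω x) ^ p) ∂(signalNoise μ J)
        - (κ * m) ^ p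
      = ∫ ω, (pathGibbs μ a b s ω (fun x => (κ * overlap a ω x) ^ p) - (κ * m) ^ p)
        ∂(signalNoise μ J) := by
    rw [integral_sub gRp.integrable (integrable_const _)]
    simp
  have e2 : κ ^ 2 * (∫ ω, pathGibbs μ a b s ω (fun x => overlap a ω x ^ 2) ∂(signalNoise μ J)
        - m ^ 2)
      = ∫ ω, κ ^ 2 * (pathGibbs μ a b s ω (fun x => overlap a ω x ^ 2)
        + ((-2 * m) * pathGibbs μ a b s ω (overlap a ω) + m ^ 2)) ∂(signalNoise μ J) := by
    have i2 := (gR.const_mul (-2 * m)).integrable (μ := signalNoise μ J)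
    have := integral_add (gRR.integrable (μ := signalNoise μ J)) (i2.add (integrable_const (m ^ 2)))
    have h3 := integral_add i2 (integrable_const (m ^ 2))
    simp only [Pi.add_apply, integral_const_mul, integral_const, probReal_univ, one_smul]
      at this h3
    rw [integral_const_mul, this, h3, ← hm]
    ring
  rw [e1, e2, ← integral_const_mul]
  have b1 := gRp.sub (IsBoundedMeasurable.const ((κ * m) ^ p))
  refine b1.sq_integral_le.trans (integral_mono (b1.pow 2).integrable
    (((gRR.add ((gR.const_mul (-2 * m)).add (.const (m ^ 2)))).const_mul _).const_mul _).integrable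
    fun ω => ?_)
  have hp := h.isProbabilityMeasure_path (μ := μ) s ω
  set T := μ.tilted (pathEnergy a b s ω)
  change (∫ x, (κ * overlap a ω x) ^ p ∂T - (κ * m) ^ p) ^ 2 ≤ (p * B ^ (p - 1)) ^ 2 *
    (κ ^ 2 * (∫ x, overlap a ω x ^ 2 ∂T + ((-2 * m) * ∫ x, overlap a ω x ∂T + m ^ 2)))
  have bp := ((bR ω).const_mul κ).pow p
  have e3 : ∫ x, (κ * overlap a ω x) ^ p ∂T - (κ * m) ^ p
      = ∫ x, ((κ * overlap a ω x) ^ p - (κ * m) ^ p) ∂T := by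
    rw [integral_sub bp.integrable (integrable_const _)]
    simp
  have e4 : ∫ x, overlap a ω x ^ 2 ∂T + ((-2 * m) * ∫ x, overlap a ω x ∂T + m ^ 2)
      = ∫ x, (overlap a ω x - m) ^ 2 ∂T := by
    have i2 := ((bR ω).const_mul (-2 * m)).integrable (μ := T)
    have h2 := integral_add (((bR ω).pow 2).integrable (μ := T)) (i2.add (integrable_const (m ^ 2)))
    have h3 := integral_add i2 (integrable_const (m ^ 2))
    simp only [Pi.add_apply, integral_const_mul, integral_const, probReal_univ, one_smul] at h2 h3
    rw [← h3, ← h2]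
    exact integral_congr_ae (Filter.Eventually.of_forall fun x => by simp only; ring)
  rw [e3, e4, ← integral_const_mul, ← integral_const_mul]
  have b2 := bp.sub (IsBoundedMeasurable.const ((κ * m) ^ p))
  refine b2.sq_integral_le.trans (integral_mono (b2.pow 2).integrable
    (((((bR ω).sub (.const m)).pow 2).const_mul _).const_mul _).integrable fun x => ?_)
  have hpow := abs_pow_sub_pow_le (κ * overlap a ω x) (κ * m) p
  have hB0 : 0 ≤ B := (abs_nonneg _).trans hmB
  have hmax : max |κ * overlap a ω x| |κ * m| ^ (p - 1) ≤ B ^ (p - 1) :=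
    pow_le_pow_left₀ (le_max_of_le_left (abs_nonneg _)) (max_le (hB ω x) hmB) _
  have h5 : |(κ * overlap a ω x) ^ p - (κ * m) ^ p|
      ≤ (p * B ^ (p - 1)) * |κ * overlap a ω x - κ * m| := by
    refine hpow.trans ?_
    rw [mul_assoc, mul_comm]
    gcongr
  calc ((κ * overlap a ω x) ^ p - (κ * m) ^ p) ^ 2
      = |(κ * overlap a ω x) ^ p - (κ * m) ^ p| ^ 2 := (sq_abs _).symm
    _ ≤ ((p * B ^ (p - 1)) * |κ * overlap a ω x - κ * m|) ^ 2 :=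
        pow_le_pow_left₀ (abs_nonneg _) h5 2
    _ = _ := by rw [mul_pow, sq_abs]; ring

end PowerOfOverlap

/-! ### The tensor model -/

/-- Truncation of a real number to `[-K, K]`. -/
noncomputable def clamp (K x : ℝ) : ℝ := max (-K) (min K x)

theorem measurable_clamp (K : ℝ) : Measurable (clamp K) := by
  unfold clamp; fun_prop

theorem abs_clamp_le {K : ℝ} (hK : 0 ≤ K) (x : ℝ) : |clamp K x| ≤ K :=
  abs_le.2 ⟨le_max_left _ _, max_le (by linarith) (min_le_left _ _)⟩

theorem clamp_eq_self {K x : ℝ} (hx : |x| ≤ K) : clamp K x = x := by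
  rw [clamp, min_eq_right (abs_le.1 hx).2, max_eq_right (abs_le.1 hx).1]

/-- The index set of the noise `(W, z)`. -/
abbrev NoiseIndex (p N : ℕ) : Type := (Fin p → Fin N) ⊕ Fin N

/-- The features `x^{⊗p} / N^{(p-1)/2}` observed through the noise `W`, with the coordinates of `x`
truncated to `[-K, K]`. -/
noncomputable def tensorFeature (K : ℝ) (p N : ℕ) (x : Fin N → ℝ) : NoiseIndex p N → ℝ :=
  Sum.elim (fun i => 1 / (N : ℝ) ^ (((p : ℝ) - 1) / 2) * ∏ k, clamp K (x (i k))) fun _ => 0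

/-- The features `x` observed through the noise `z`, with the coordinates of `x` truncated to
`[-K, K]`. -/
noncomputable def vectorFeature (K : ℝ) (p N : ℕ) (x : Fin N → ℝ) : NoiseIndex p N → ℝ :=
  Sum.elim (fun _ => 0) fun i => clamp K (x i)

/-- The disorder `(x̄, W, z)` as a pair of a signal and of a noise vector. -/
def toSignalNoise {p N : ℕ} (ω : Disorder p N) : (Fin N → ℝ) × (NoiseIndex p N → ℝ) :=
  (ω.1, Sum.elim ω.2.1 ω.2.2)

theorem measurePreserving_toSignalNoise (P : Measure ℝ) [IsProbabilityMeasure P] (p N : ℕ) :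
    MeasurePreserving (toSignalNoise (p := p) (N := N)) (disorderLaw P p N)
      (signalNoise (Measure.pi fun _ => P) (NoiseIndex p N)) :=
  (MeasurePreserving.id _).prod
    (measurePreserving_sumPiEquivProdPi_symm fun _ : NoiseIndex p N => gaussianReal 0 1)

theorem integral_toSignalNoise {P : Measure ℝ} [IsProbabilityMeasure P] {p N : ℕ}
    {F : (Fin N → ℝ) × (NoiseIndex p N → ℝ) → ℝ} (hF : Measurable F) :
    ∫ ω, F (toSignalNoise ω) ∂(disorderLaw P p N)
      = ∫ η, F η ∂(signalNoise (Measure.pi fun _ => P) (NoiseIndex p N)) := by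
  have hmp := measurePreserving_toSignalNoise P p N
  rw [← hmp.map_eq, integral_map hmp.measurable.aemeasurable hF.aestronglyMeasurable]

variable {K : ℝ} {p N : ℕ}

theorem measurable_tensorFeature : Measurable (tensorFeature K p N) := by
  rw [measurable_pi_iff]
  rintro (i | i)
  · exact (Finset.measurable_prod _ fun k _ =>
      (measurable_clamp K).comp (measurable_pi_apply (i k))).const_mul _
  · exact measurable_const

theorem measurable_vectorFeature : Measurable (vectorFeature K p N) := by
  rw [measurable_pi_iff]
  rintro (i | i)
  · exact measurable_const
  · exact (measurable_clamp K).comp (measurable_pi_apply i)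

theorem abs_tensorFeature_le (hK : 0 ≤ K) (x : Fin N → ℝ) (j : NoiseIndex p N) :
    |tensorFeature K p N x j| ≤ 1 / (N : ℝ) ^ (((p : ℝ) - 1) / 2) * K ^ p := by
  rcases j with i | i
  · simp only [tensorFeature, Sum.elim_inl]
    rw [abs_mul, abs_of_nonneg (by positivity), Finset.abs_prod]
    gcongr
    refine (Finset.prod_le_prod (fun _ _ => abs_nonneg _)
      fun k _ => abs_clamp_le hK (x (i k))).trans_eq ?_
    simp
  · simp only [tensorFeature, Sum.elim_inr, abs_zero]
    positivity

theorem abs_vectorFeature_le (hK : 0 ≤ K) (x : Fin N → ℝ) (j : NoiseIndex p N) :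
    |vectorFeature K p N x j| ≤ K := by
  rcases j with i | i
  · simpa [vectorFeature] using hK
  · exact abs_clamp_le hK _

theorem abs_mul_le_of_nonneg {r c B : ℝ} (hr : 0 ≤ r) (hc : |c| ≤ B) : |r * c| ≤ r * B := by
  rw [abs_mul, abs_of_nonneg hr]
  exact mul_le_mul_of_nonneg_left hc hr

theorem isFeatureSplit_tensor (hK : 0 ≤ K) (h : ℝ) :
    ∃ M, IsFeatureSplit (tensorFeature K p N) (fun x j => √h * vectorFeature K p N x j) M := by
  have h0 : 0 ≤ √h * K := by positivity
  have h1 : 0 ≤ 1 / (N : ℝ) ^ (((p : ℝ) - 1) / 2) * K ^ p := by positivity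
  refine ⟨_, ⟨measurable_tensorFeature, ?_, add_nonneg h1 h0,
    fun x j => (abs_tensorFeature_le hK x j).trans (le_add_of_nonneg_right h0),
    fun x j => (abs_mul_le_of_nonneg (Real.sqrt_nonneg h)
      (abs_vectorFeature_le hK x j)).trans (le_add_of_nonneg_left h1), ?_⟩⟩
  · have := measurable_pi_iff.1 (measurable_vectorFeature (K := K) (p := p) (N := N))
    exact measurable_pi_iff.2 fun j => (this j).const_mul _
  · rintro (i | i)
    · exact Or.inr fun x => by simp [vectorFeature]
    · exact Or.inl fun x => by simp [tensorFeature]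

theorem isFeatureSplit_vector (hK : 0 ≤ K) (t : ℝ) :
    ∃ M, IsFeatureSplit (vectorFeature K p N) (fun x j => √t * tensorFeature K p N x j) M := by
  have h1 : 0 ≤ √t * (1 / (N : ℝ) ^ (((p : ℝ) - 1) / 2) * K ^ p) := by positivity
  refine ⟨_, ⟨measurable_vectorFeature, ?_, add_nonneg hK h1,
    fun x j => (abs_vectorFeature_le hK x j).trans (le_add_of_nonneg_right h1),
    fun x j => (abs_mul_le_of_nonneg (Real.sqrt_nonneg t)
      (abs_tensorFeature_le hK x j)).trans (le_add_of_nonneg_left hK), ?_⟩⟩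
  · have := measurable_pi_iff.1 (measurable_tensorFeature (K := K) (p := p) (N := N))
    exact measurable_pi_iff.2 fun j => (this j).const_mul _
  · rintro (i | i)
    · exact Or.inl fun x => by simp [vectorFeature]
    · exact Or.inr fun x => by simp [tensorFeature]

theorem featurePath_comm (t h : ℝ) :
    featurePath (tensorFeature K p N) (fun x j => √h * vectorFeature K p N x j) t
      = featurePath (vectorFeature K p N) (fun x j => √t * tensorFeature K p N x j) h := by
  ext x j
  simp only [featurePath]
  ring

/-- `u^{⊗p} · v^{⊗p} = (u · v)^p`. -/
theorem sum_prod_mul_prod (p : ℕ) {N : ℕ} (u v : Fin N → ℝ) :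
    ∑ i : Fin p → Fin N, (∏ k, u (i k)) * ∏ k, v (i k) = (dotProduct u v) ^ p := by
  rw [dotProduct, Fintype.sum_pow]
  simp only [Finset.prod_mul_distrib]

theorem sq_one_div_rpow (p N : ℕ) :
    (1 / (N : ℝ) ^ (((p : ℝ) - 1) / 2)) ^ 2 = 1 / (N : ℝ) ^ ((p : ℝ) - 1) := by
  rw [div_pow, one_pow, ← Real.rpow_natCast, ← Real.rpow_mul (Nat.cast_nonneg N)]
  norm_num

/-- The Hamiltonian is the log-likelihood of the observation of the signal through the features
`√t x^{⊗p} / N^{(p-1)/2}` and `√h x`. -/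
theorem hamiltonian_eq_energy {t h : ℝ} (ht : 0 ≤ t) (hh : 0 ≤ h) {ω : Disorder p N}
    (hω : ∀ i, |ω.1 i| ≤ K) {x : Fin N → ℝ} (hx : ∀ i, |x i| ≤ K) :
    hamiltonian ω t h x
      = pathEnergy (vectorFeature K p N) (fun x j => √t * tensorFeature K p N x j) h
        (toSignalNoise ω) x := by
  have hc := sq_one_div_rpow p N
  set c := 1 / (N : ℝ) ^ (((p : ℝ) - 1) / 2) with hcdef
  have e1 : ∑ i : Fin p → Fin N, ((ω.2.1 i + √t * (c * ∏ k, ω.1 (i k))) * (√t * (c * ∏ k, x (i k)))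
      - (√t * (c * ∏ k, x (i k))) ^ 2 / 2)
      = √t * c * tensorContract ω.2.1 x + t * c ^ 2 * (dotProduct x ω.1) ^ p
        - t * c ^ 2 / 2 * (dotProduct x x) ^ p := by
    rw [tensorContract, ← sum_prod_mul_prod, ← sum_prod_mul_prod, Finset.mul_sum, Finset.mul_sum,
      Finset.mul_sum, ← Finset.sum_add_distrib, ← Finset.sum_sub_distrib]
    refine Finset.sum_congr rfl fun i _ => ?_
    have := Real.sq_sqrt ht
    linear_combination (c ^ 2 * (∏ k, x (i k)) * ∏ k, ω.1 (i k)) * this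
      - (c ^ 2 * (∏ k, x (i k)) ^ 2 / 2) * this
  have e2 : ∑ i : Fin N, ((ω.2.2 i + √h * ω.1 i) * (√h * x i) - (√h * x i) ^ 2 / 2)
      = √h * dotProduct ω.2.2 x + h * dotProduct x ω.1 - h / 2 * dotProduct x x := by
    simp only [dotProduct]
    rw [Finset.mul_sum, Finset.mul_sum, Finset.mul_sum, ← Finset.sum_add_distrib,
      ← Finset.sum_sub_distrib]
    refine Finset.sum_congr rfl fun i _ => ?_
    have := Real.sq_sqrt hh
    linear_combination (x i * ω.1 i) * this - (x i ^ 2 / 2) * this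
  rw [pathEnergy, energy, Fintype.sum_sum_type]
  simp only [featurePath, toSignalNoise, tensorFeature, vectorFeature, Pi.add_apply, Sum.elim_inl,
    Sum.elim_inr, mul_zero, zero_add, add_zero, clamp_eq_self (hω _), clamp_eq_self (hx _)]
  rw [← hcdef, e1, e2, hc, hamiltonian, hcdef]
  ring

variable {P : Measure ℝ} [IsProbabilityMeasure P]

theorem ae_pi_forall_abs_le (hP : ∀ᵐ x ∂P, |x| ≤ K) :
    ∀ᵐ x ∂(Measure.pi fun _ : Fin N => P), ∀ i, |x i| ≤ K :=
  ae_all_iff.2 fun i =>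
    (measurePreserving_eval (fun _ : Fin N => P) i).quasiMeasurePreserving.ae hP

theorem ae_disorderLaw_forall_abs_le (hP : ∀ᵐ x ∂P, |x| ≤ K) :
    ∀ᵐ ω ∂(disorderLaw P p N), ∀ i, |ω.1 i| ≤ K :=
  Measure.quasiMeasurePreserving_fst.ae (ae_pi_forall_abs_le hP)

theorem freeEnergy_eq (hP : ∀ᵐ x ∂P, |x| ≤ K) {t h : ℝ} (ht : 0 ≤ t) (hh : 0 ≤ h)
    {ω : Disorder p N} (hω : ∀ i, |ω.1 i| ≤ K) :
    freeEnergy P ω t h = 1 / (N : ℝ) * pathLog (Measure.pi fun _ => P) (vectorFeature K p N)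
      (fun x j => √t * tensorFeature K p N x j) h (toSignalNoise ω) := by
  rw [freeEnergy, pathLog]
  congr 2
  refine integral_congr_ae ?_
  filter_upwards [ae_pi_forall_abs_le hP] with x hx
  rw [hamiltonian_eq_energy ht hh hω hx]

theorem meanFreeEnergy_eq (hP : ∀ᵐ x ∂P, |x| ≤ K) {t h : ℝ} (ht : 0 ≤ t) (hh : 0 ≤ h) :
    meanFreeEnergy P p N t h = 1 / (N : ℝ) * ∫ η, pathLog (Measure.pi fun _ => P)
      (vectorFeature K p N) (fun x j => √t * tensorFeature K p N x j) h η
      ∂(signalNoise (Measure.pi fun _ => P) (NoiseIndex p N)) := by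
  obtain ⟨M, hM⟩ := isFeatureSplit_vector (K := K) (p := p) (N := N)
    ((abs_nonneg _).trans hP.exists.choose_spec) t
  rw [← integral_const_mul, ← integral_toSignalNoise ((hM.measurable_pathLog h).const_mul _)]
  refine integral_congr_ae ?_
  filter_upwards [ae_disorderLaw_forall_abs_le hP] with ω hω
  exact freeEnergy_eq hP ht hh hω

/-- The averaged free energy along the direction of `t`; the splitting of the features is the other
one. -/
theorem meanFreeEnergy_eq' (hP : ∀ᵐ x ∂P, |x| ≤ K) {t h : ℝ} (ht : 0 ≤ t) (hh : 0 ≤ h) :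
    meanFreeEnergy P p N t h = 1 / (N : ℝ) * ∫ η, pathLog (Measure.pi fun _ => P)
      (tensorFeature K p N) (fun x j => √h * vectorFeature K p N x j) t η
      ∂(signalNoise (Measure.pi fun _ => P) (NoiseIndex p N)) := by
  rw [meanFreeEnergy_eq hP ht hh]
  simp only [pathLog, pathEnergy, featurePath_comm]

theorem pathGibbs_comm (μ : Measure (Fin N → ℝ)) (t h : ℝ) :
    pathGibbs μ (tensorFeature K p N) (fun x j => √h * vectorFeature K p N x j) t
      = pathGibbs μ (vectorFeature K p N) (fun x j => √t * tensorFeature K p N x j) h := by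
  ext ω f
  simp only [pathGibbs, featurePath_comm]

theorem overlap_vectorFeature (ω : (Fin N → ℝ) × (NoiseIndex p N → ℝ)) (x : Fin N → ℝ) :
    overlap (vectorFeature K p N) ω x
      = dotProduct (fun i => clamp K (ω.1 i)) fun i => clamp K (x i) := by
  simp [overlap, vectorFeature, dotProduct]

/-- The overlap of the tensor features is `N` times the `p`-th power of the normalized overlap. -/
theorem overlap_tensorFeature (hp : 1 ≤ p) (hN : 1 ≤ N)
    (ω : (Fin N → ℝ) × (NoiseIndex p N → ℝ)) (x : Fin N → ℝ) :
    overlap (tensorFeature K p N) ω x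
      = N * (1 / (N : ℝ) * overlap (vectorFeature K p N) ω x) ^ p := by
  have hN' : (N : ℝ) ≠ 0 := by positivity
  have hc := sq_one_div_rpow p N
  rw [overlap_vectorFeature, overlap, Fintype.sum_sum_type]
  simp only [tensorFeature, Sum.elim_inl, Sum.elim_inr, mul_zero, Finset.sum_const_zero, add_zero]
  set c := 1 / (N : ℝ) ^ (((p : ℝ) - 1) / 2)
  have e : ∀ i : Fin p → Fin N, (c * ∏ k, clamp K (ω.1 (i k))) * (c * ∏ k, clamp K (x (i k)))
      = c ^ 2 * ((∏ k, clamp K (ω.1 (i k))) * ∏ k, clamp K (x (i k))) := fun i => by ring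
  simp only [e]
  rw [← Finset.mul_sum, sum_prod_mul_prod p (fun i => clamp K (ω.1 i)) fun i => clamp K (x i), hc,
    mul_pow, ← mul_assoc]
  congr 1
  obtain ⟨q, rfl⟩ : ∃ q, p = q + 1 := ⟨p - 1, by omega⟩
  rw [Nat.cast_add, Nat.cast_one, add_sub_cancel_right, Real.rpow_natCast,
    div_pow, one_pow, pow_succ]
  field_simp

theorem abs_inv_mul_overlap_vectorFeature_le (hK : 0 ≤ K) (hN : 1 ≤ N)
    (ω : (Fin N → ℝ) × (NoiseIndex p N → ℝ)) (x : Fin N → ℝ) :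
    |1 / (N : ℝ) * overlap (vectorFeature K p N) ω x| ≤ K ^ 2 := by
  have hN' : (0 : ℝ) < N := by positivity
  rw [overlap_vectorFeature, abs_mul, abs_of_pos (by positivity), one_div, inv_mul_le_iff₀ hN']
  refine (Finset.abs_sum_le_sum_abs _ _).trans ((Finset.sum_le_sum fun i _ => ?_).trans_eq
    (b := ∑ _i : Fin N, K ^ 2) (by simp))
  rw [abs_mul, sq]
  exact mul_le_mul (abs_clamp_le hK _) (abs_clamp_le hK _) (abs_nonneg _) hK

theorem sum_sq_vectorFeature_le (hK : 0 ≤ K) (x : Fin N → ℝ) :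
    ∑ j, vectorFeature K p N x j ^ 2 ≤ N * K ^ 2 := by
  rw [Fintype.sum_sum_type]
  simp only [vectorFeature, Sum.elim_inl, Sum.elim_inr]
  refine (add_le_add (b := 0) (d := ∑ _i : Fin N, K ^ 2) (by simp)
    (Finset.sum_le_sum fun i _ => ?_)).trans_eq (by simp)
  rw [← sq_abs]
  exact pow_le_pow_left₀ (abs_nonneg _) (abs_clamp_le hK _) 2

end TensorHJ

open TensorHJ
theorem proposition3 (P : Measure ℝ) [IsProbabilityMeasure P]
    (hP : ∃ K : ℝ, ∀ᵐ x ∂P, |x| ≤ K) (p : ℕ) (hp : 1 ≤ p) :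
    ∃ C : ℝ, 0 < C ∧ ∀ N : ℕ, 1 ≤ N → ∀ t h : ℝ, 0 ≤ t → 0 ≤ h →
      -- the averaged free energy and its first derivatives are well defined on `[0,∞)²`
      Integrable (fun ω => freeEnergy P ω t h) (disorderLaw P p N) ∧
      DifferentiableWithinAt ℝ (fun s => meanFreeEnergy P p N s h) (Set.Ici 0) t ∧
      DifferentiableWithinAt ℝ (fun k => meanFreeEnergy P p N t k) (Set.Ici 0) h ∧
      0 ≤ partialH (meanFreeEnergy P p N) t h ∧
      -- the right side of the inequality is `+∞` for `h = 0`
      (0 < h →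
        -- the quantities on the right side are well defined
        DifferentiableWithinAt ℝ (fun k => partialH (meanFreeEnergy P p N) t k) (Set.Ici 0) h ∧
        (∀ᵐ ω ∂(disorderLaw P p N),
          DifferentiableWithinAt ℝ (fun k => freeEnergy P ω t k) (Set.Ici 0) h) ∧
        Integrable (fun ω => (partialH (freeEnergy P ω) t h
          - partialH (meanFreeEnergy P p N) t h) ^ 2) (disorderLaw P p N) ∧
        |partialT (meanFreeEnergy P p N) t h
            - 2 ^ (p - 1) * (partialH (meanFreeEnergy P p N) t h) ^ p| ^ 2
          ≤ C / N * partialH (partialH (meanFreeEnergy P p N)) t h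
            + C * ∫ ω, (partialH (freeEnergy P ω) t h
                - partialH (meanFreeEnergy P p N) t h) ^ 2 ∂(disorderLaw P p N)
            + C / N * (1 / h + 1 / Real.sqrt h)) := by
  obtain ⟨K, hK1, hK⟩ : ∃ K : ℝ, 1 ≤ K ∧ ∀ᵐ x ∂P, |x| ≤ K := by
    obtain ⟨K, hK⟩ := hP
    exact ⟨max K 1, le_max_right _ _, hK.mono fun x hx => hx.trans (le_max_left _ _)⟩
  have hK0 : 0 ≤ K := zero_le_one.trans hK1
  set L : ℝ := p * (K ^ 2) ^ (p - 1) with hL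
  have hL0 : 0 < L := by positivity
  refine ⟨L ^ 2 * K ^ 2, by positivity, fun N hN t h ht hh => ?_⟩
  have hN0 : (0 : ℝ) < N := by positivity
  set μ : Measure (Fin N → ℝ) := Measure.pi fun _ => P with hμ
  set Q := signalNoise μ (NoiseIndex p N) with hQ
  set a := vectorFeature K p N with ha
  set b : (Fin N → ℝ) → NoiseIndex p N → ℝ := fun x j => √t * tensorFeature K p N x j with hb
  set R := overlap (J := NoiseIndex p N) a with hR
  obtain ⟨M, hM⟩ := isFeatureSplit_vector (K := K) (p := p) (N := N) hK0 t
  obtain ⟨M', hM'⟩ := isFeatureSplit_tensor (K := K) (p := p) (N := N) hK0 h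
  set m : ℝ → ℝ := fun k => ∫ η, pathGibbs μ a b k η (R η) ∂Q with hm
  -- The two first derivatives of the averaged free energy, as averages of the overlap.
  have dH : ∀ k, 0 ≤ k → HasDerivWithinAt (fun k => meanFreeEnergy P p N t k)
      (1 / (N : ℝ) * (1 / 2 * m k)) (Set.Ici 0) k := fun k hk =>
    ((hM.hasDerivWithinAt_integral_pathLog (μ := μ) hk).const_mul (1 / (N : ℝ))).congr
      (fun u hu => meanFreeEnergy_eq hK ht hu) (meanFreeEnergy_eq hK ht hk)
  have dT : HasDerivWithinAt (fun s => meanFreeEnergy P p N s h)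
      (1 / 2 * ∫ η, pathGibbs μ a b h η (fun x => (1 / (N : ℝ) * R η x) ^ p) ∂Q) (Set.Ici 0) t := by
    refine (((hM'.hasDerivWithinAt_integral_pathLog (μ := μ) ht).const_mul (1 / (N : ℝ))).congr
      (fun u hu => meanFreeEnergy_eq' hK hu hh) (meanFreeEnergy_eq' hK ht hh)).congr_deriv ?_
    have e : ∀ η, overlap (tensorFeature K p N) η
        = fun x => (N : ℝ) * (1 / (N : ℝ) * R η x) ^ p := fun η =>
      funext fun x => overlap_tensorFeature hp hN η x
    simp only [pathGibbs_comm, e, IsFeatureSplit.pathGibbs_const_mul, integral_const_mul]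
    field_simp
    rfl
  have pH : ∀ k, 0 ≤ k → partialH (meanFreeEnergy P p N) t k = 1 / (N : ℝ) * (1 / 2 * m k) :=
    fun k hk => (dH k hk).derivWithin (uniqueDiffOn_Ici 0 k hk)
  have pT := dT.derivWithin (uniqueDiffOn_Ici 0 t ht)
  refine ⟨?_, dT.differentiableWithinAt, (dH h hh).differentiableWithinAt, ?_, fun hpos => ?_⟩
  · have hi := ((hM.integrable_pathLog (μ := μ) h).const_mul (1 / (N : ℝ)))
    refine ((measurePreserving_toSignalNoise P p N).integrable_comp_of_integrable hi).congr ?_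
    filter_upwards [ae_disorderLaw_forall_abs_le hK] with ω hω
    exact (freeEnergy_eq hK ht hh hω).symm
  · rw [pH h hh]
    have := hM.integral_overlap_nonneg (μ := μ) h
    positivity
  obtain ⟨D, hD0, hD, hconc⟩ := hM.overlap_concentration (μ := μ) hpos (S := N * K ^ 2)
    fun x => sum_sq_vectorFeature_le hK0 x
  obtain ⟨hi, hvar⟩ := hconc (m h) rfl
  have dHH : HasDerivWithinAt (fun k => partialH (meanFreeEnergy P p N) t k)
      (1 / (N : ℝ) * D) (Set.Ici 0) h :=
    (hD.hasDerivWithinAt.const_mul (1 / (N : ℝ))).congr (fun u hu => pH u hu) (pH h hh)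
  -- On the full-measure event where the signal lies in `[-K, K]^N`, truncation changes nothing.
  have dF : ∀ᵐ ω ∂(disorderLaw P p N), HasDerivWithinAt (fun k => freeEnergy P ω t k)
      (1 / (N : ℝ) * pathGibbs μ a b h (toSignalNoise ω) (score a h (toSignalNoise ω)))
      (Set.Ici 0) h := by
    filter_upwards [ae_disorderLaw_forall_abs_le hK] with ω hω
    exact ((hM.hasDerivAt_pathLog hpos (toSignalNoise ω)).hasDerivWithinAt.const_mul
      (1 / (N : ℝ))).congr (fun u hu => freeEnergy_eq hK ht hu hω) (freeEnergy_eq hK ht hh hω)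
  have eF : ∀ᵐ ω ∂(disorderLaw P p N), (1 / (N : ℝ)) ^ 2 *
      (pathGibbs μ a b h (toSignalNoise ω) (score a h (toSignalNoise ω)) - 1 / 2 * m h) ^ 2
      = (partialH (freeEnergy P ω) t h - partialH (meanFreeEnergy P p N) t h) ^ 2 := by
    filter_upwards [dF] with ω hω
    rw [pH h hh, partialH, hω.derivWithin (uniqueDiffOn_Ici 0 h hh)]
    ring
  have iF := (measurePreserving_toSignalNoise P p N).integrable_comp_of_integrable
    (hi.const_mul ((1 / (N : ℝ)) ^ 2))
  have intF : ∫ ω, (partialH (freeEnergy P ω) t h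
        - partialH (meanFreeEnergy P p N) t h) ^ 2 ∂(disorderLaw P p N)
      = (1 / (N : ℝ)) ^ 2 * ∫ η, (pathGibbs μ a b h η (score a h η) - 1 / 2 * m h) ^ 2 ∂Q := by
    rw [← integral_const_mul, ← integral_toSignalNoise
      ((((hM.measurable_pathGibbs_score h).sub_const _).pow_const 2).const_mul _)]
    exact (integral_congr_ae eF).symm
  refine ⟨dHH.differentiableWithinAt, dF.mono fun ω hω => hω.differentiableWithinAt,
    iF.congr eF, ?_⟩
  have hpow := hM.sq_integral_overlap_pow_sub_le (μ := μ) h p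
    (abs_inv_mul_overlap_vectorFeature_le hK0 hN) (m := m h) rfl
  have e2 : (2 : ℝ) ^ (p - 1) * (1 / (N : ℝ) * (1 / 2 * m h)) ^ p
      = 1 / 2 * (1 / (N : ℝ) * m h) ^ p := by
    obtain ⟨q, rfl⟩ : ∃ q, p = q + 1 := ⟨p - 1, by omega⟩
    rw [Nat.add_sub_cancel, show 1 / (N : ℝ) * (1 / 2 * m h) = (1 / 2) * (1 / (N : ℝ) * m h) by ring,
      mul_pow _ _ (q + 1), pow_succ (1 / 2 : ℝ), ← mul_assoc, ← mul_assoc, ← mul_pow]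
    norm_num
  have eHH : partialH (partialH (meanFreeEnergy P p N)) t h = 1 / (N : ℝ) * D :=
    dHH.derivWithin (uniqueDiffOn_Ici 0 h hh)
  have eT : partialT (meanFreeEnergy P p N) t h = _ := pT
  rw [intF, eT, pH h hh, e2, eHH, ← mul_sub, sq_abs, mul_pow]
  set V := ∫ η, (pathGibbs μ a b h η (score a h η) - 1 / 2 * m h) ^ 2 ∂Q with hV
  have hV0 : 0 ≤ V := integral_nonneg fun η => sq_nonneg _
  set Y := (∫ η, pathGibbs μ a b h η (fun x => (1 / (N : ℝ) * R η x) ^ p) ∂Q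
    - (1 / (N : ℝ) * m h) ^ p) ^ 2 with hY
  have h1 : Y ≤ L ^ 2 * ((1 / (N : ℝ)) ^ 2 * (4 * (D + N * K ^ 2 / (4 * h) + V))) :=
    hpow.trans (by gcongr)
  have hK2 : 1 ≤ K ^ 2 := one_le_pow₀ hK1
  -- As `D ≥ 0`, the constant may be enlarged to `L² K²` in front of the second derivative too.
  calc (1 / 2) ^ 2 * Y
      ≤ (1 / 2) ^ 2 * (L ^ 2 * ((1 / (N : ℝ)) ^ 2 * (4 * (D + N * K ^ 2 / (4 * h) + V)))) := by
        gcongr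
    _ = L ^ 2 * 1 * ((1 / (N : ℝ)) * (1 / (N : ℝ) * D)) + L ^ 2 * 1 * ((1 / (N : ℝ)) ^ 2 * V)
        + L ^ 2 * K ^ 2 * (1 / (N : ℝ)) * (1 / 4 * (1 / h)) := by field_simp; ring
    _ ≤ L ^ 2 * K ^ 2 * ((1 / (N : ℝ)) * (1 / (N : ℝ) * D))
        + L ^ 2 * K ^ 2 * ((1 / (N : ℝ)) ^ 2 * V)
        + L ^ 2 * K ^ 2 * (1 / (N : ℝ)) * (1 / h + 1 / √h) := by
        have h2 : 0 ≤ 1 / h := by positivity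
        have h3 : 0 ≤ 1 / √h := by positivity
        gcongr
        linarith
    _ = _ := by ring
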